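/- **Theorem (ML-duality for symmetric matrices).** Let $1\le r\le m$ be integers. For $1\le k\le m$ let $\mathcal{SM}_k$ be the set of symmetric complex $m\times m$-matrices $P$ of rank $k$ with all entries non-zero and $\sum_{i,j}P_{ij}=2$; write $p_{ij}=P_{ij}$ for $i<j$ and $p_{ii}=P_{ii}/2$, so that $\sum_{i\le j}p_{ij}=1$. For data $u=(u_{ij})_{i\le j}$ let $U$ be the symmetric matrix with $U_{ij}=u_{ij}$ for $i<j$ and $U_{ii}=2u_{ii}$, and put $U_{i+}=\sum_j U_{ij}$, $U_{++}=\sum_{i,j}U_{ij}$. The likelihood function is $\ell_U(P)=\prod_{i\le j}p_{ij}^{u_{ij}}$. A point $P\in\mathcal{SM}_k$ is a critical point of $\ell_U$ on $\mathcal{SM}_k$ if the (logarithmic) derivative $\sum_{i\le j}u_{ij}x_{ij}/p_{ij}$, where $x_{ij}=X_{ij}$ for $i<j$ and $x_{ii}=X_{ii}/2$, vanishes for every $X$ in the Zariski tangent space of $\mathcal{SM}_k$ at $P$; this condition makes sense for arbitrary complex data $u$. "Sufficiently general $u$" means all $u\in\mathbb{C}^{m(m+1)/2}$ outside the zero set of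 some non-zero polynomial. The ML-degree of $\mathcal{SM}_k$ is the finite number of critical points of $\ell_U$ on $\mathcal{SM}_k$ that is attained for all sufficiently general $u$. For sufficiently general $u$ the following hold. 1. For $P$ a critical point of $\ell_U$ on $\mathcal{SM}_r$ define $Q$ by $P_{ij}Q_{ij}=U_{i+}U_{ij}U_{j+}$. Then $Q'=4Q/(U_{++})^3$ is a critical point of $\ell_U$ on $\mathcal{SM}_{m-r+1}$, and $P\mapsto Q'$ is a bijection from the critical points of $\ell_U$ on $\mathcal{SM}_r$ onto those on $\mathcal{SM}_{m-r+1}$, whose inverse is given by the same formula. 2. If the $u_{ij}$ are natural numbers, then $\ell_U(P)\,\ell_U(Q')$ is the same for all critical points $P$ of $\ell_U$ on $\mathcal{SM}_r$. Moreover, the ML-degrees of $\mathcal{SM}_r$ and $\mathcal{SM}_{m-r+1}$ exist and coincide. -/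

import Mathlib

namespace MLDuality

/-- The property `S` holds for all sufficiently general complex parameter vectors `u`, that is,
for all `u` in some non-empty Zariski-open subset of affine space. -/
def ForGeneral {σ : Type*} (S : (σ → ℂ) → Prop) : Prop :=
  ∃ F : MvPolynomial σ ℂ, F ≠ 0 ∧ ∀ u : σ → ℂ, MvPolynomial.eval u F ≠ 0 → S u

/-- The Zariski tangent space at `P` of a locally closed set `Z` of complex `m × m`-matrices:
the matrices `X` annihilated by the differential at `P` of each polynomial vanishing on `Z`. -/
def tangentSpace {m : ℕ} (Z : Set (Matrix (Fin m) (Fin m) ℂ)) (P : Matrix (Fin m) (Fin m) ℂ) :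
    Set (Matrix (Fin m) (Fin m) ℂ) :=
  {X | ∀ f : MvPolynomial (Fin m × Fin m) ℂ,
    (∀ Y ∈ Z, MvPolynomial.eval (fun a => Y a.1 a.2) f = 0) →
    ∑ a : Fin m × Fin m,
      MvPolynomial.eval (fun b => P b.1 b.2) (MvPolynomial.pderiv a f) * X a.1 a.2 = 0}

/-- The variety of symmetric matrices of rank `r` with non-zero entries whose entries sum to `2`.
In the coordinates `p i j = P i j` (`i < j`) and `p i i = P i i / 2`, the last condition reads
`∑ i ≤ j, p i j = 1`. -/
def SM (m r : ℕ) : Set (Matrix (Fin m) (Fin m) ℂ) :=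
  {P | P.IsSymm ∧ (∀ i j, P i j ≠ 0) ∧ ∑ i, ∑ j, P i j = 2 ∧ P.rank = r}

/-- The pairs `(i, j)` with `i ≤ j`. -/
def upper (m : ℕ) : Finset (Fin m × Fin m) :=
  Finset.univ.filter fun a => a.1 ≤ a.2

/-- The coordinates of a symmetric matrix `P`: `p i j = P i j` for `i ≠ j`, and
`p i i = P i i / 2`. -/
noncomputable def coord {m : ℕ} (P : Matrix (Fin m) (Fin m) ℂ) (i j : Fin m) : ℂ :=
  if i = j then P i i / 2 else P i j

/-- The symmetric data matrix `U` of the data `u`: `U i j = u i j` for `i ≠ j`, and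
`U i i = 2 * u i i`. -/
def dataMatrix {m : ℕ} (u : Sym2 (Fin m) → ℂ) : Matrix (Fin m) (Fin m) ℂ :=
  Matrix.of fun i j => if i = j then 2 * u s(i, i) else u s(i, j)

/-- The likelihood function `∏ i ≤ j, p i j ^ u i j` for natural data `u`. -/
noncomputable def likelihood {m : ℕ} (u : Sym2 (Fin m) → ℕ) (P : Matrix (Fin m) (Fin m) ℂ) : ℂ :=
  ∏ a ∈ upper m, coord P a.1 a.2 ^ u s(a.1, a.2)

/-- The logarithmic derivative `∑ i ≤ j, u i j * x i j / p i j` of the likelihood function at `P`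
in the direction `X`, for complex data `u`. -/
noncomputable def logDerivative {m : ℕ} (u : Sym2 (Fin m) → ℂ)
    (P X : Matrix (Fin m) (Fin m) ℂ) : ℂ :=
  ∑ a ∈ upper m, u s(a.1, a.2) * (coord X a.1 a.2 / coord P a.1 a.2)

/-- For natural data, the derivative of the likelihood function at `P` in the direction `X` is
the likelihood of `P`, which is non-zero, times `logDerivative`. -/
theorem hasDerivAt_likelihood {m : ℕ} (u : Sym2 (Fin m) → ℕ) (P X : Matrix (Fin m) (Fin m) ℂ)
    (hP : ∀ i j, P i j ≠ 0) :
    likelihood u P ≠ 0 ∧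
    HasDerivAt (fun t : ℂ => likelihood u (P + t • X))
      (likelihood u P * logDerivative (fun s => (u s : ℂ)) P X) 0 := by
  have hc : ∀ i j, coord P i j ≠ 0 := by
    intro i j
    unfold coord
    split_ifs
    · exact div_ne_zero (hP i i) two_ne_zero
    · exact hP i j
  have hadd : ∀ (t : ℂ) i j, coord (P + t • X) i j = coord P i j + t * coord X i j := by
    intro t i j
    unfold coord
    split_ifs <;> simp <;> ring
  refine ⟨Finset.prod_ne_zero_iff.2 fun a _ => pow_ne_zero _ (hc _ _), ?_⟩
  have h1 : ∀ a ∈ upper m, HasDerivAt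
      (fun t : ℂ => (coord P a.1 a.2 + t * coord X a.1 a.2) ^ u s(a.1, a.2))
      ((u s(a.1, a.2) : ℂ) * (coord P a.1 a.2 + 0 * coord X a.1 a.2) ^ (u s(a.1, a.2) - 1)
        * (1 * coord X a.1 a.2)) 0 := fun a _ =>
    (((hasDerivAt_id (0 : ℂ)).mul_const (coord X a.1 a.2)).const_add (coord P a.1 a.2)).pow _
  have h2 := HasDerivAt.fun_finsetProd h1
  simp only [likelihood, hadd]
  refine h2.congr_deriv ?_
  symm
  unfold logDerivative
  rw [Finset.mul_sum]
  refine Finset.sum_congr rfl fun a ha => ?_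
  rw [← Finset.mul_prod_erase _ _ ha]
  simp only [zero_mul, add_zero, one_mul, smul_eq_mul]
  have := hc a.1 a.2
  rcases Nat.eq_zero_or_pos (u s(a.1, a.2)) with h0 | h0
  · simp [h0]
  · obtain ⟨k, hk⟩ := Nat.exists_eq_succ_of_ne_zero h0.ne'
    rw [hk]
    simp only [Nat.succ_eq_add_one, Nat.add_sub_cancel, pow_succ]
    field_simp

/-- The critical points on `SM m r` of the likelihood function with data `u`: the points at which
the (logarithmic) derivative of the likelihood function vanishes on the tangent space. -/
def criticalPoints (m r : ℕ) (u : Sym2 (Fin m) → ℂ) : Set (Matrix (Fin m) (Fin m) ℂ) :=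
  {P | P ∈ SM m r ∧ ∀ X ∈ tangentSpace (SM m r) P, logDerivative u P X = 0}

/-- `d` is the ML-degree of `SM m r`: for sufficiently general data there are exactly `d` critical
points. -/
def IsMLDegree (m r d : ℕ) : Prop :=
  ForGeneral fun u : Sym2 (Fin m) → ℂ => (criticalPoints m r u).encard = d

/-- The row sums `U i +` of a matrix. -/
def rowSum {m : ℕ} (U : Matrix (Fin m) (Fin m) ℂ) (i : Fin m) : ℂ := ∑ j, U i j

/-- The sum `U + +` of all entries of a matrix. -/
def totalSum {m : ℕ} (U : Matrix (Fin m) (Fin m) ℂ) : ℂ := ∑ i, ∑ j, U i j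

/-- The matrix `4 Q / (U + +) ^ 3`, where `P i j * Q i j = (U i +) * U i j * (U j +)`. -/
noncomputable def dual {m : ℕ} (U P : Matrix (Fin m) (Fin m) ℂ) : Matrix (Fin m) (Fin m) ℂ :=
  (4 / totalSum U ^ 3) • Matrix.of fun i j => rowSum U i * U i j * rowSum U j / P i j

end MLDuality

/-! ### General parameters. -/

namespace MLDuality
open MvPolynomial Matrix

/-! Write `c = U₊₊/2`, let `J` be the all-ones matrix, `U/P` the entrywise quotient and `R = U/P -
cJ` (`residual`). The logarithmic derivative at `P` in direction `X` is `tr((U/P) X)/2`. Testing it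
on the tangent vectors `AP + PAᵀ` with entry sum zero gives `PR = 0`. Conversely, `PR = 0` suffices,
since tangent vectors are orthogonal to symmetric matrices whose columns lie in `ker P`
(`mem_criticalPoints_iff`).

The diagonal of `PR = 0` says that the row sums of `U` are `c` times those of `P`, so `DJ = cPJ`
with `D = diag(U_{i+})`. Also `rank R ≤ m - r`, and in case of equality `U/P = R + cJ` has rank `m -
r + 1` (`rank_quot`). The dual is `(4/U₊₊³) D (U/P) D`, and its entrywise quotient is a multiple of
`D⁻¹PD⁻¹`; duality thus swaps the roles of `P` and `U/P`, and the critical equation passes from one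
to the other (`dual_mem_criticalPoints`). Entrywise, `P` times its dual depends on `U` only, whence
the involution and the constant product of likelihoods.

It remains to see that `rank R = m - r` for general data. After a permutation, `cP = [1 X]ᵀ A [1 X]`
and `c⁻¹R = [-X; 1] T [-X; 1]ᵀ`, and `U` is the entrywise product of `cP` and `c⁻¹R + J`. So the
data are polynomials in `(A, X, T)`, and there are as many parameters as data. Each polynomial in
the parameters therefore satisfies a non-trivial relation over the data. For `det T` this confines
the zeros to special data (`forGeneral_ne_zero_of_param`); for the entries of `cP` it bounds the
number of critical points.

The ML-degree exists because, by Chevalley's theorem, for each `k` either general data have at least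
`k` critical points or general data have fewer (`forGeneral_le_encard_or`); the degree is the
largest `k` of the first kind. -/

theorem ForGeneral.mono {σ : Type*} {S T : (σ → ℂ) → Prop} (hS : ForGeneral S)
    (h : ∀ u, S u → T u) : ForGeneral T := by
  obtain ⟨F, hF, hu⟩ := hS
  exact ⟨F, hF, fun u h0 => h u (hu u h0)⟩

theorem forGeneral_of_forall {σ : Type*} {S : (σ → ℂ) → Prop} (h : ∀ u, S u) : ForGeneral S :=
  ⟨1, one_ne_zero, fun u _ => h u⟩

theorem ForGeneral.and {σ : Type*} {S T : (σ → ℂ) → Prop} (hS : ForGeneral S)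
    (hT : ForGeneral T) : ForGeneral fun u => S u ∧ T u := by
  obtain ⟨F, hF, hu⟩ := hS
  obtain ⟨G, hG, hv⟩ := hT
  refine ⟨F * G, mul_ne_zero hF hG, fun u h0 => ?_⟩
  rw [map_mul] at h0
  exact ⟨hu u (left_ne_zero_of_mul h0), hv u (right_ne_zero_of_mul h0)⟩

theorem forGeneral_forall {σ ι : Type*} [Finite ι] {S : ι → (σ → ℂ) → Prop}
    (h : ∀ i, ForGeneral (S i)) : ForGeneral fun u => ∀ i, S i u := by
  classical
  have := Fintype.ofFinite ι
  choose F hF hu using h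
  refine ⟨∏ i, F i, Finset.prod_ne_zero_iff.2 fun i _ => hF i, fun u h0 i => hu i u ?_⟩
  rw [map_prod] at h0
  exact Finset.prod_ne_zero_iff.1 h0 i (Finset.mem_univ i)

/-- A non-zero polynomial is non-zero at general points. -/
theorem forGeneral_eval_ne_zero {σ : Type*} {F : MvPolynomial σ ℂ} (hF : F ≠ 0) :
    ForGeneral fun u => eval u F ≠ 0 :=
  ⟨F, hF, fun _ h => h⟩

/-! ### Elimination: solvability of polynomial systems with parameters. -/

/-- A constructible subset of the spectrum of a domain which contains the generic point contains
a non-empty basic open set. -/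
theorem exists_basicOpen_subset_of_isConstructible {R : Type*} [CommRing R] [IsDomain R]
    {s : Set (PrimeSpectrum R)} (hs : Topology.IsConstructible s) (h0 : ⊥ ∈ s) :
    ∃ f : R, f ≠ 0 ∧ (PrimeSpectrum.basicOpen f : Set (PrimeSpectrum R)) ⊆ s := by
  obtain ⟨S, rfl⟩ := PrimeSpectrum.exists_constructibleSetData_iff.2 hs
  simp only [PrimeSpectrum.ConstructibleSetData.toSet, Set.mem_iUnion] at h0
  obtain ⟨C, hC, hg, hf⟩ := h0
  -- The locally closed piece containing the generic point is cut out by equations `g` lying in the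
  -- zero ideal, so it is the basic open set of `C.f`.
  refine ⟨C.f, fun h => hf ?_, fun p hp => ?_⟩
  · rw [h]; simp
  · simp only [PrimeSpectrum.ConstructibleSetData.toSet, Set.mem_iUnion]
    refine ⟨C, hC, fun x hx => ?_, fun h => hp (h rfl)⟩
    have : x = 0 := hg hx
    rw [this]
    exact zero_mem _

/-- The solvability of a polynomial system with parameters either holds for general parameters
or fails for general parameters. -/
theorem forGeneral_or_forGeneral_not {σ τ : Type*} [Finite σ] [Finite τ]
    (I : Set (MvPolynomial (σ ⊕ τ) ℂ)) :
    (ForGeneral fun u : σ → ℂ => ∃ x : τ → ℂ, ∀ p ∈ I, eval (Sum.elim u x) p = 0) ∨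
    ForGeneral fun u : σ → ℂ => ¬ ∃ x : τ → ℂ, ∀ p ∈ I, eval (Sum.elim u x) p = 0 := by
  let ι : MvPolynomial σ ℂ →+* MvPolynomial (σ ⊕ τ) ℂ :=
    (rename Sum.inl : MvPolynomial σ ℂ →ₐ[ℂ] MvPolynomial (σ ⊕ τ) ℂ).toRingHom
  let J := Ideal.span I
  let f : MvPolynomial σ ℂ →+* MvPolynomial (σ ⊕ τ) ℂ ⧸ J := (Ideal.Quotient.mk J).comp ι
  by_cases hf : Function.Injective f
  · left
    have hft : f.FiniteType := by
      refine RingHom.FiniteType.comp (RingHom.FiniteType.of_surjective _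
        Ideal.Quotient.mk_surjective) ?_
      have : (algebraMap ℂ (MvPolynomial (σ ⊕ τ) ℂ)).FiniteType :=
        (RingHom.finiteType_algebraMap).2 inferInstance
      refine RingHom.FiniteType.of_comp_finiteType (f := algebraMap ℂ (MvPolynomial σ ℂ)) ?_
      have h2 : ι.comp (algebraMap ℂ (MvPolynomial σ ℂ))
          = algebraMap ℂ (MvPolynomial (σ ⊕ τ) ℂ) := by
        ext x : 1
        simp [ι, algebraMap_eq]
      rwa [h2]
    have hfp := RingHom.FinitePresentation.of_finiteType.1 hft
    have hc := PrimeSpectrum.isConstructible_range_comap hfp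
    -- Under an injective ring map every minimal prime of the source is a contraction, so the
    -- generic point lies in the image on spectra.
    obtain ⟨p, hp, hpf⟩ := Ideal.exists_comap_eq_of_mem_minimalPrimes_of_injective hf ⊥
      (by simp [IsDomain.minimalPrimes_eq_singleton_bot])
    obtain ⟨F, hF, hsub⟩ := exists_basicOpen_subset_of_isConstructible hc
      ⟨⟨p, hp⟩, PrimeSpectrum.ext hpf⟩
    refine ⟨F, hF, fun u hu => ?_⟩
    have hm : (vanishingIdeal ℂ {u}).IsPrime :=
      (isMaximal_iff_eq_vanishingIdeal_singleton.2 ⟨u, rfl⟩ : (vanishingIdeal ℂ {u}).IsMaximal).isPrime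
    obtain ⟨q, hq⟩ := hsub (show (⟨vanishingIdeal ℂ {u}, hm⟩ : PrimeSpectrum _) ∈ _ by
      simpa [PrimeSpectrum.mem_basicOpen, mem_vanishingIdeal_singleton_iff, aeval_eq_eval] using hu)
    -- By the Nullstellensatz a maximal ideal above the prime `q` over `u` is a point `z`. It solves
    -- the system, and its parameter part is `u` because `M` contains each `X i - C (u i)`.
    obtain ⟨M, hM, hle⟩ := Ideal.exists_le_maximal (q.asIdeal.comap (Ideal.Quotient.mk J))
      (Ideal.IsPrime.ne_top (Ideal.IsPrime.comap _))
    obtain ⟨z, hz⟩ := isMaximal_iff_eq_vanishingIdeal_singleton.1 hM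
    have hzu : ∀ i, z (Sum.inl i) = u i := by
      intro i
      have h1 : (X i - C (u i) : MvPolynomial σ ℂ) ∈ vanishingIdeal ℂ {u} := by
        simp
      have h2 : (vanishingIdeal ℂ {u}) = Ideal.comap f q.asIdeal :=
        (congrArg PrimeSpectrum.asIdeal hq).symm
      rw [h2] at h1
      have h3 : ι (X i - C (u i)) ∈ M := hle h1
      rw [hz, mem_vanishingIdeal_singleton_iff] at h3
      simpa [ι, sub_eq_zero] using h3
    refine ⟨fun t => z (Sum.inr t), fun p hp => ?_⟩
    have h4 : p ∈ M := hle (by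
      rw [Ideal.mem_comap, Ideal.Quotient.eq_zero_iff_mem.2 (Ideal.subset_span hp)]
      exact zero_mem _)
    rw [hz, mem_vanishingIdeal_singleton_iff] at h4
    have : Sum.elim u (fun t => z (Sum.inr t)) = z := by
      ext (i | i) <;> simp [hzu]
    rw [this]
    simpa [aeval_eq_eval] using h4
  -- A non-zero kernel element `F` is a consequence of the equations in the parameters alone, so it
  -- vanishes at every `u` admitting a solution.
  · right
    rw [injective_iff_map_eq_zero] at hf
    push Not at hf
    obtain ⟨F, hF0, hF⟩ := hf
    refine ⟨F, hF, fun u hu => ?_⟩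
    rintro ⟨x, hx⟩
    have h1 : ι F ∈ J := Ideal.Quotient.eq_zero_iff_mem.1 hF0
    have h2 : J ≤ RingHom.ker (eval (Sum.elim u x)) := Ideal.span_le.2 fun p hp => hx p hp
    have h3 : eval (Sum.elim u x) (rename Sum.inl F) = 0 := h2 h1
    rw [eval_rename] at h3
    exact hu h3

/-! ### Polynomial maps whose source has at most the dimension of the target. -/

/-- Along a polynomial map whose source has at most the dimension of its target, each polynomial
function is algebraic over the coordinates of the map. -/
theorem exists_algebraic_relation {π σ : Type} [Finite π] [Finite σ]
    (hc : Nat.card π ≤ Nat.card σ) (φ : σ → MvPolynomial π ℂ) (g : MvPolynomial π ℂ) :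
    ∃ G : Polynomial (MvPolynomial σ ℂ), G ≠ 0 ∧
      ∀ x : π → ℂ, (G.map (eval fun s => eval x (φ s))).eval (eval x g) = 0 := by
  -- Together `g` and the `φ s` are more polynomials than the transcendence degree of the polynomial
  -- ring.
  have h : ¬ AlgebraicIndependent ℂ (fun o : Option σ => o.elim g φ) := by
    intro h
    have h1 := h.cardinalMk_le_trdeg
    rw [MvPolynomial.trdeg_of_isDomain, Cardinal.lift_id] at h1
    have h2 : Nat.card (Option σ) ≤ Nat.card π := by
      have := Fintype.ofFinite π
      have := Fintype.ofFinite σ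
      simp only [Cardinal.mk_fintype, Nat.cast_le] at h1
      simpa [Nat.card_eq_fintype_card] using h1
    rw [Finite.card_option] at h2
    omega
  rw [algebraicIndependent_iff] at h
  push Not at h
  obtain ⟨p, hp, hp0⟩ := h
  refine ⟨optionEquivLeft ℂ σ p, by simpa using hp0, fun x => ?_⟩
  have key : ∀ p : MvPolynomial (Option σ) ℂ,
      ((optionEquivLeft ℂ σ p).map (eval fun s => eval x (φ s))).eval (eval x g)
        = eval x (aeval (fun o : Option σ => o.elim g φ) p) := by
    intro p
    induction p using MvPolynomial.induction_on with
    | C a => simp [optionEquivLeft_C, algebraMap_eq]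
    | add p q hp hq => simp [hp, hq]
    | mul_X p o hp =>
      cases o with
      | none => simp [hp, optionEquivLeft_X_none]
      | some s => simp [hp, optionEquivLeft_X_some]
  rw [key, hp, map_zero]

/-- For general `u`, no point at which `g` vanishes is mapped to `u`, if the source of the
polynomial map `φ` has at most the dimension of its target. -/
theorem forGeneral_ne_zero_of_param {π σ : Type} [Finite π] [Finite σ]
    (hc : Nat.card π ≤ Nat.card σ) (φ : σ → MvPolynomial π ℂ) {g : MvPolynomial π ℂ} (hg : g ≠ 0) :
    ForGeneral fun u : σ → ℂ => ∀ x : π → ℂ, (∀ s, eval x (φ s) = u s) → eval x g ≠ 0 := by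
  obtain ⟨G, hG, hx⟩ := exists_algebraic_relation hc φ g
  -- Powers of the variable are split off so that the constant coefficient is non-zero. The relation
  -- for `H` holds where `g ≠ 0`, hence everywhere, since polynomials over `ℂ` form a domain. At a
  -- zero of `g` over `u` it says that `H.coeff 0` vanishes at `u`.
  obtain ⟨n, H, hH, hGH⟩ : ∃ n, ∃ H : Polynomial (MvPolynomial σ ℂ), H.coeff 0 ≠ 0 ∧
      G = Polynomial.X ^ n * H := by
    obtain ⟨H, hGH, hH⟩ := Polynomial.exists_eq_pow_rootMultiplicity_mul_and_not_dvd G hG 0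
    refine ⟨_, H, fun h => hH ?_, by simpa using hGH⟩
    simpa [Polynomial.X_dvd_iff] using h
  have hprod : ∀ x : π → ℂ, eval x g ≠ 0 →
      (H.map (eval fun s => eval x (φ s))).eval (eval x g) = 0 := by
    intro x h0
    have := hx x
    rw [hGH] at this
    simpa [h0] using this
  have hpoly : ∀ x : π → ℂ, (H.map (eval fun s => eval x (φ s))).eval (eval x g) = 0 := by
    let w : MvPolynomial π ℂ := (H.map (aeval φ : MvPolynomial σ ℂ →ₐ[ℂ] _).toRingHom).eval g
    have hw : ∀ x, eval x w = (H.map (eval fun s => eval x (φ s))).eval (eval x g) := by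
      intro x
      simp only [w]
      rw [← Polynomial.eval₂_hom, Polynomial.eval₂_eq_eval_map, Polynomial.map_map]
      congr 2
      ext
      · simp [algebraMap_eq]
      · simp
    have : w * g = 0 := by
      refine MvPolynomial.funext fun x => ?_
      rw [map_mul, map_zero, hw]
      by_cases h0 : eval x g = 0
      · rw [h0, mul_zero]
      · rw [hprod x h0, zero_mul]
    have hw0 : w = 0 := (mul_eq_zero.1 this).resolve_right hg
    intro x
    rw [← hw, hw0, map_zero]
  refine ⟨H.coeff 0, hH, fun u hu x hxu h0 => hu ?_⟩
  have h1 := hpoly x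
  rw [h0, ← Polynomial.coeff_zero_eq_eval_zero, Polynomial.coeff_map] at h1
  rwa [← funext hxu]

/-- For general `u`, a polynomial function takes only a bounded number of values on the fibre of
`φ` over `u`, if the source of the polynomial map `φ` has at most the dimension of its target. -/
theorem exists_forGeneral_finset_of_param {π σ : Type} [Finite π] [Finite σ]
    (hc : Nat.card π ≤ Nat.card σ) (φ : σ → MvPolynomial π ℂ) (g : MvPolynomial π ℂ) :
    ∃ K : ℕ, ForGeneral fun u : σ → ℂ => ∃ s : Finset ℂ, s.card ≤ K ∧
      ∀ x : π → ℂ, (∀ i, eval x (φ i) = u i) → eval x g ∈ s := by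
  obtain ⟨G, hG, hx⟩ := exists_algebraic_relation hc φ g
  -- The values of `g` on the fibre are roots of `G` specialised at `u`, which stays non-zero where
  -- the leading coefficient does not vanish.
  refine ⟨G.natDegree, G.leadingCoeff, Polynomial.leadingCoeff_ne_zero.2 hG, fun u hu => ?_⟩
  have h0 : G.map (eval u) ≠ 0 := fun h => hu (by
    rw [Polynomial.leadingCoeff, ← Polynomial.coeff_map, h, Polynomial.coeff_zero])
  classical
  refine ⟨(G.map (eval u)).roots.toFinset, ?_, fun x hxu => ?_⟩
  · exact (Multiset.toFinset_card_le _).trans ((Polynomial.card_roots' _).trans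
      Polynomial.natDegree_map_le)
  · rw [Multiset.mem_toFinset, Polynomial.mem_roots h0, Polynomial.IsRoot, ← funext hxu]
    exact hx x

/-! ### Symmetric matrices of fixed rank. -/

/-- A symmetric matrix of rank `r` has, after a simultaneous permutation of rows and columns, the
form `[1 X]ᵀ A [1 X]` with `A` symmetric and invertible of size `r`. -/
theorem exists_symm_chart {m r s : ℕ} (hm : m = r + s) {P : Matrix (Fin m) (Fin m) ℂ}
    (hP : P.IsSymm) (hr : P.rank = r) :
    ∃ (e : Fin r ⊕ Fin s ≃ Fin m) (A : Matrix (Fin r) (Fin r) ℂ) (X : Matrix (Fin r) (Fin s) ℂ),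
      A.IsSymm ∧ IsUnit A ∧ P.submatrix e e = fromBlocks A (A * X) (Xᵀ * A) (Xᵀ * A * X) := by
  classical
  obtain ⟨κ, a, ha, hspan, hli⟩ := exists_linearIndependent' ℂ P.col
  have : Finite κ := Finite.of_injective a ha
  have := Fintype.ofFinite κ
  have hcard : Fintype.card κ = r := by
    rw [← hr, Matrix.rank_eq_finrank_span_cols, ← hspan]
    exact (finrank_span_eq_card hli).symm
  let k : Fin r ≃ κ := (Fintype.equivFinOfCardEq hcard).symm
  have hinj : Function.Injective (a ∘ k) := ha.comp k.injective
  have hcompl : Fintype.card {x // ¬ x ∈ Set.range (a ∘ k)} = s := by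
    rw [Fintype.card_subtype_compl]
    have : Fintype.card {x // x ∈ Set.range (a ∘ k)} = r := by
      rw [← Fintype.card_congr (Equiv.ofInjective _ hinj), Fintype.card_fin]
    rw [this, Fintype.card_fin, hm, Nat.add_sub_cancel_left]
  let e : Fin r ⊕ Fin s ≃ Fin m :=
    ((Equiv.ofInjective _ hinj).sumCongr (Fintype.equivFinOfCardEq hcompl).symm).trans
      (Equiv.sumCompl (· ∈ Set.range (a ∘ k)))
  have hli' : LinearIndependent ℂ fun i : Fin r => P.col (e (Sum.inl i)) :=
    (hli.comp k k.injective)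
  have hmem : ∀ j, ∃ x : Fin r → ℂ, ∑ i, x i • P.col (e (Sum.inl i)) = P.col (e (Sum.inr j)) := by
    intro j
    rw [← Submodule.mem_span_range_iff_exists_fun]
    have h1 : Set.range (fun i : Fin r => P.col (e (Sum.inl i))) = Set.range (P.col ∘ a) :=
      k.surjective.range_comp (P.col ∘ a)
    rw [h1, hspan]
    exact Submodule.subset_span ⟨_, rfl⟩
  choose x hx using hmem
  let A : Matrix (Fin r) (Fin r) ℂ := P.submatrix (e ∘ Sum.inl) (e ∘ Sum.inl)
  let X : Matrix (Fin r) (Fin s) ℂ := Matrix.of fun i j => x j i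
  have hA : A.IsSymm := hP.submatrix _
  have hcol : ∀ (l : Fin m) j, P l (e (Sum.inr j)) = ∑ i, P l (e (Sum.inl i)) * x j i := by
    intro l j
    have := congrFun (hx j) l
    simp only [Finset.sum_apply, Pi.smul_apply, smul_eq_mul, Matrix.col_apply] at this
    rw [← this]
    exact Finset.sum_congr rfl fun i _ => mul_comm _ _
  have h12 : P.submatrix (e ∘ Sum.inl) (e ∘ Sum.inr) = A * X := by
    ext i j
    simp [A, X, Matrix.mul_apply, hcol]
  have h21 : P.submatrix (e ∘ Sum.inr) (e ∘ Sum.inl) = Xᵀ * A := by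
    rw [← hA.eq, ← Matrix.transpose_mul, ← h12, Matrix.transpose_submatrix, hP.eq]
  have h22 : P.submatrix (e ∘ Sum.inr) (e ∘ Sum.inr) = Xᵀ * A * X := by
    rw [← h21]
    ext i j
    simp [X, Matrix.mul_apply, hcol]
  have hM : P.submatrix e e = fromBlocks A (A * X) (Xᵀ * A) (Xᵀ * A * X) := by
    rw [← h22, ← h21, ← h12]
    ext (i | i) (j | j) <;> rfl
  refine ⟨e, A, X, hA, ?_, hM⟩
  -- If `A v = 0`, then also `Xᵀ A v = 0`, so `v` is a linear relation among the chosen independent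
  -- columns of `P`.
  rw [← Matrix.mulVec_injective_iff_isUnit]
  refine (injective_iff_map_eq_zero A.mulVecLin).2 fun v hv => ?_
  have hv' : A *ᵥ v = 0 := hv
  refine funext (Fintype.linearIndependent_iff.1 hli' v ?_)
  ext l
  obtain ⟨l, rfl⟩ := e.surjective l
  simp only [Finset.sum_apply, Pi.smul_apply, smul_eq_mul, Matrix.col_apply, Pi.zero_apply]
  cases l with
  | inl l =>
    have := congrFun hv' l
    simpa [Matrix.mulVec, dotProduct, A, mul_comm] using this
  | inr l =>
    have h1 : (Xᵀ * A) *ᵥ v = 0 := by rw [← Matrix.mulVec_mulVec, hv', Matrix.mulVec_zero]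
    rw [← h21] at h1
    have := congrFun h1 l
    simpa [Matrix.mulVec, dotProduct, mul_comm] using this

/-- A matrix has rank `r` if it is a generalised rank factorisation of size `r`. -/
theorem rank_eq_of_factor {n : Type*} [Fintype n] [DecidableEq n] {r : ℕ} {P : Matrix n n ℂ}
    {C : Matrix (Fin r) n ℂ} {E : Matrix n (Fin r) ℂ} (h1 : C * P * E = 1)
    (h2 : P * E * (C * P) = P) : P.rank = r := by
  apply le_antisymm
  · rw [← h2]
    exact (Matrix.rank_mul_le_right _ _).trans ((Matrix.rank_le_card_height _).trans (by simp))
  · calc r = (C * P * E).rank := by rw [h1, Matrix.rank_one, Fintype.card_fin]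
      _ ≤ (C * P).rank := Matrix.rank_mul_le_left _ _
      _ ≤ P.rank := Matrix.rank_mul_le_right _ _

/-- In a chart, `C = [A⁻¹ 0]` gives `C P = [1 X]`, and `E = [1; 0]` gives `P E = [1 X]ᵀ A`. The two
equations express the rank by polynomial equations with witnesses, as elimination requires; `C` and
`E` also serve to border `P` in the study of tangent vectors. -/
theorem exists_factor_of_rank_eq {m r : ℕ} {P : Matrix (Fin m) (Fin m) ℂ} (hP : P.IsSymm)
    (hr : P.rank = r) : ∃ (C : Matrix (Fin r) (Fin m) ℂ) (E : Matrix (Fin m) (Fin r) ℂ),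
      C * P * E = 1 ∧ P * E * (C * P) = P := by
  have hrm : r ≤ m := by rw [← hr]; exact P.rank_le_width
  obtain ⟨e, A, X, hA, hu, hM⟩ := exists_symm_chart (s := m - r) (by omega) hP hr
  let C₀ : Matrix (Fin r) (Fin r ⊕ Fin (m - r)) ℂ := fromCols A⁻¹ 0
  let E₀ : Matrix (Fin r ⊕ Fin (m - r)) (Fin r) ℂ := fromRows 1 0
  have hdet := (Matrix.isUnit_iff_isUnit_det A).1 hu
  have hCP : C₀ * P.submatrix e e = fromCols 1 X := by
    rw [hM]
    simp [C₀, Matrix.fromCols_mul_fromBlocks, Matrix.nonsing_inv_mul A hdet,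
      Matrix.nonsing_inv_mul_cancel_left A X hdet]
  have hPE : P.submatrix e e * E₀ = fromRows A (Xᵀ * A) := by
    rw [hM]
    simp [E₀, Matrix.fromBlocks_mul_fromRows]
  have h1 : C₀ * P.submatrix e e * E₀ = 1 := by
    rw [hCP]
    simp [E₀, Matrix.fromCols_mul_fromRows]
  have h2 : P.submatrix e e * E₀ * (C₀ * P.submatrix e e) = P.submatrix e e := by
    rw [hCP, hPE, hM]
    simp
  have hPe : P = (P.submatrix e e).submatrix e.symm e.symm := by ext; simp
  refine ⟨C₀.submatrix id e.symm, E₀.submatrix e.symm id, ?_, ?_⟩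
  · rw [hPe, Matrix.submatrix_mul_equiv, Matrix.submatrix_mul_equiv, h1, Matrix.submatrix_id_id]
  · conv_lhs => rw [hPe]
    rw [Matrix.submatrix_mul_equiv, Matrix.submatrix_mul_equiv]
    rw [← Matrix.submatrix_mul _ _ _ _ _ Function.bijective_id, h2, ← hPe]

/-- A symmetric matrix annihilated by `[1 X]ᵀ A [1 X]`, where `A` is invertible, has the form
`[-X; 1] T [-X; 1]ᵀ`. -/
theorem eq_of_chart_mul_eq_zero {r s : ℕ} {A : Matrix (Fin r) (Fin r) ℂ} (hu : IsUnit A)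
    {X : Matrix (Fin r) (Fin s) ℂ} {S : Matrix (Fin r ⊕ Fin s) (Fin r ⊕ Fin s) ℂ} (hS : S.IsSymm)
    (h : fromBlocks A (A * X) (Xᵀ * A) (Xᵀ * A * X) * S = 0) :
    ∃ T : Matrix (Fin s) (Fin s) ℂ, T.IsSymm ∧
      S = fromBlocks (X * T * Xᵀ) (-(X * T)) (-(T * Xᵀ)) T := by
  have hdet := (Matrix.isUnit_iff_isUnit_det A).1 hu
  obtain ⟨S₁, S₂, S₃, T, rfl⟩ : ∃ S₁ S₂ S₃ T, S = fromBlocks S₁ S₂ S₃ T :=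
    ⟨_, _, _, _, (Matrix.fromBlocks_toBlocks S).symm⟩
  obtain ⟨h1, h21, h12, hT⟩ := Matrix.isSymm_fromBlocks_iff.1 hS
  rw [Matrix.fromBlocks_multiply, ← Matrix.fromBlocks_zero, Matrix.fromBlocks_inj] at h
  obtain ⟨h3, h4, -, -⟩ := h
  have key : ∀ {q : ℕ} {Y : Matrix (Fin r) (Fin q) ℂ} {Z : Matrix (Fin s) (Fin q) ℂ},
      A * Y + A * X * Z = 0 → Y = -(X * Z) := by
    intro q Y Z h
    rw [Matrix.mul_assoc, ← Matrix.mul_add] at h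
    have := congrArg (A⁻¹ * ·) h
    simp only [Matrix.nonsing_inv_mul_cancel_left A _ hdet, Matrix.mul_zero] at this
    exact eq_neg_of_add_eq_zero_left this
  have e1 := key h3
  have e2 := key h4
  have e3 : S₃ = -(T * Xᵀ) := by
    rw [← h21, e2, Matrix.transpose_neg, Matrix.transpose_mul, hT.eq]
  refine ⟨T, hT, ?_⟩
  rw [e1, e3, e2]
  simp [Matrix.mul_assoc]

/-! ### Tangent vectors of `SM m r`. -/

/-- The chain rule for a polynomial along a curve. -/
theorem hasDerivAt_eval_comp {ι : Type*} [Fintype ι] (f : MvPolynomial ι ℂ) {γ : ℂ → ι → ℂ}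
    {γ' : ι → ℂ} {t : ℂ} (hγ : ∀ i, HasDerivAt (fun s => γ s i) (γ' i) t) :
    HasDerivAt (fun s => eval (γ s) f) (∑ i, eval (γ t) (pderiv i f) * γ' i) t := by
  classical
  induction f using MvPolynomial.induction_on with
  | C a => simpa using hasDerivAt_const t a
  | add p q hp hq =>
    simp only [map_add, add_mul, Finset.sum_add_distrib]
    exact hp.add hq
  | mul_X p i hp =>
    simp only [map_mul, eval_X]
    refine (hp.mul (hγ i)).congr_deriv ?_
    simp only [Derivation.leibniz, pderiv_X, smul_eq_mul, map_add, map_mul, eval_X, add_mul,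
      Finset.sum_add_distrib, Finset.sum_mul]
    rw [add_comm]
    congr 1
    · rw [Finset.sum_eq_single i (fun j _ hj => by simp [hj.symm]) (by simp)]
      simp
    · exact Finset.sum_congr rfl fun j _ => by ring

/-- The velocity of a curve in `Z` is a tangent vector. -/
theorem mem_tangentSpace_of_curve {m : ℕ} {Z : Set (Matrix (Fin m) (Fin m) ℂ)}
    {γ : ℂ → Matrix (Fin m) (Fin m) ℂ} {X : Matrix (Fin m) (Fin m) ℂ}
    (hγ : ∀ i j, HasDerivAt (fun t => γ t i j) (X i j) 0) (hZ : ∀ᶠ t in nhds 0, γ t ∈ Z) :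
    X ∈ tangentSpace Z (γ 0) := by
  intro f hf
  have h1 := hasDerivAt_eval_comp f (γ := fun t a => γ t a.1 a.2) (γ' := fun a => X a.1 a.2)
    (t := 0) fun a => hγ a.1 a.2
  refine h1.unique ((hasDerivAt_const (0 : ℂ) (0 : ℂ)).congr_of_eventuallyEq ?_)
  filter_upwards [hZ] with t ht using hf _ ht

/-- A polynomial function vanishing on `Z` has vanishing derivative along tangent vectors. -/
theorem deriv_eq_zero_of_mem_tangentSpace {m : ℕ} {Z : Set (Matrix (Fin m) (Fin m) ℂ)}
    {P X : Matrix (Fin m) (Fin m) ℂ} (hX : X ∈ tangentSpace Z P)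
    (f : MvPolynomial (Fin m × Fin m) ℂ) (g : Matrix (Fin m) (Fin m) ℂ → ℂ)
    (hfg : ∀ Y, eval (fun a => Y a.1 a.2) f = g Y) (hg : ∀ Y ∈ Z, g Y = 0) :
    HasDerivAt (fun t : ℂ => g (P + t • X)) 0 0 := by
  have h1 := hasDerivAt_eval_comp f (γ := fun t a => (P + t • X) a.1 a.2)
    (γ' := fun a => X a.1 a.2) (t := 0) fun a => by
      simpa using ((hasDerivAt_id (0 : ℂ)).mul_const (X a.1 a.2)).const_add (P a.1 a.2)
  have h2 := hX f fun Y hY => by rw [hfg, hg Y hY]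
  simp only [zero_smul, add_zero] at h1
  rw [h2] at h1
  simpa [← hfg] using h1

theorem isSymm_of_mem_tangentSpace {m r : ℕ} {P X : Matrix (Fin m) (Fin m) ℂ}
    (hX : X ∈ tangentSpace (SM m r) P) (hP : P.IsSymm) : X.IsSymm := by
  ext i j
  have h := deriv_eq_zero_of_mem_tangentSpace hX (MvPolynomial.X (j, i) - MvPolynomial.X (i, j))
    (fun Y => Y j i - Y i j) (fun Y => by simp) fun Y hY => by rw [hY.1.apply, sub_self]
  have h2 : HasDerivAt (fun t : ℂ => t * (X j i - X i j)) (1 * (X j i - X i j)) 0 :=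
    (hasDerivAt_id (0 : ℂ)).mul_const _
  have h3 : (fun t : ℂ => (P + t • X) j i - (P + t • X) i j) = fun t : ℂ => t * (X j i - X i j) := by
    ext t
    simp [hP.apply i j]
    ring
  rw [h3] at h
  have := h2.unique h
  rw [one_mul, sub_eq_zero] at this
  exact this

theorem sum_eq_zero_of_mem_tangentSpace {m r : ℕ} {P X : Matrix (Fin m) (Fin m) ℂ}
    (hX : X ∈ tangentSpace (SM m r) P) : ∑ i, ∑ j, X i j = 0 := by
  have h := deriv_eq_zero_of_mem_tangentSpace hX
    (∑ i, ∑ j, MvPolynomial.X (i, j) - MvPolynomial.C 2)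
    (fun Y => ∑ i, ∑ j, Y i j - 2) (fun Y => by simp) fun Y hY => by rw [hY.2.2.1, sub_self]
  have h2 : HasDerivAt (fun t : ℂ => ∑ i, ∑ j, P i j + t * (∑ i, ∑ j, X i j) - 2)
      (1 * (∑ i, ∑ j, X i j)) 0 :=
    (((hasDerivAt_id (0 : ℂ)).mul_const _).const_add _).sub_const _
  have h3 : (fun t : ℂ => ∑ i, ∑ j, (P + t • X) i j - 2)
      = fun t : ℂ => ∑ i, ∑ j, P i j + t * (∑ i, ∑ j, X i j) - 2 := by
    ext t
    simp [Finset.sum_add_distrib, Finset.mul_sum]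
  rw [h3] at h
  simpa using h2.unique h

/-- The derivative at `0` of `det (diag(1, 0) + t W)`. -/
theorem hasDerivAt_det_fromBlocks {r : ℕ} (W₁ : Matrix (Fin r) (Fin r) ℂ)
    (W₂ : Matrix (Fin r) Unit ℂ) (W₃ : Matrix Unit (Fin r) ℂ) (W₄ : Matrix Unit Unit ℂ) :
    HasDerivAt (fun t : ℂ => (fromBlocks (1 + t • W₁) (t • W₂) (t • W₃) (t • W₄)).det)
      (W₄ () ()) 0 := by
  -- The last block row is divisible by `t`, so the derivative at `0` is the remaining determinant
  -- at `t = 0`.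
  have h1 : ∀ t : ℂ, (fromBlocks (1 + t • W₁) (t • W₂) (t • W₃) (t • W₄)).det
      = t * (fromBlocks (1 + t • W₁) (t • W₂) W₃ W₄).det := by
    intro t
    have : fromBlocks (1 + t • W₁) (t • W₂) (t • W₃) (t • W₄)
        = fromBlocks 1 0 0 (t • (1 : Matrix Unit Unit ℂ))
          * fromBlocks (1 + t • W₁) (t • W₂) W₃ W₄ := by
      simp [Matrix.fromBlocks_multiply]
    rw [this, Matrix.det_mul, Matrix.det_fromBlocks_zero₂₁]
    simp
  have h2 : Continuous fun t : ℂ => (fromBlocks (1 + t • W₁) (t • W₂) W₃ W₄).det := by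
    fun_prop
  simp only [h1]
  rw [hasDerivAt_iff_tendsto_slope]
  have h3 : W₄ () () = (fromBlocks (1 + (0 : ℂ) • W₁) ((0 : ℂ) • W₂) W₃ W₄).det := by
    simp [Matrix.det_fromBlocks_zero₁₂]
  rw [h3]
  refine ((h2.tendsto 0).mono_left nhdsWithin_le_nhds).congr' ?_
  filter_upwards [self_mem_nhdsWithin] with t ht
  have : t ≠ 0 := ht
  simp [slope_def_field]
  field_simp

/-- Tangent vectors of the variety of symmetric matrices of rank `r` at `P` map the kernel of `P`
into the image of `P`. -/
theorem dotProduct_eq_zero_of_mem_tangentSpace {m r : ℕ} {P X : Matrix (Fin m) (Fin m) ℂ}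
    (hX : X ∈ tangentSpace (SM m r) P) (hP : P ∈ SM m r) {y z : Fin m → ℂ}
    (hy : P *ᵥ y = 0) (hz : P *ᵥ z = 0) : y ⬝ᵥ X *ᵥ z = 0 := by
  obtain ⟨hsymm, -, -, hrank⟩ := hP
  obtain ⟨C, E, h1, -⟩ := exists_factor_of_rank_eq hsymm hrank
  -- Bordered by kernel vectors, `C' * Y * E'` has size `r + 1`, so its determinant vanishes on rank
  -- `r`. At `Y = P` it is `diag(1, 0)`, and the derivative of the determinant in direction `X` is
  -- `y ⬝ᵥ X *ᵥ z`.
  let C' : Matrix (Fin r ⊕ Unit) (Fin m) ℂ := fromRows C (replicateRow Unit y)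
  let E' : Matrix (Fin m) (Fin r ⊕ Unit) ℂ := fromCols E (replicateCol Unit z)
  have hPz : P * replicateCol Unit z = 0 := by
    rw [← Matrix.replicateCol_mulVec, hz]; rfl
  have hyP : replicateRow Unit y * P = 0 := by
    rw [← Matrix.replicateRow_vecMul, ← hsymm.eq, Matrix.vecMul_transpose, hy]; rfl
  let f : MvPolynomial (Fin m × Fin m) ℂ :=
    (Matrix.of fun a b : Fin r ⊕ Unit => ∑ k, (∑ j, MvPolynomial.C (C' a j) * MvPolynomial.X (j, k))
      * MvPolynomial.C (E' k b)).det
  have h := deriv_eq_zero_of_mem_tangentSpace hX f (fun Y => (C' * Y * E').det)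
    (fun Y => by
      simp only [f]
      rw [RingHom.map_det]
      congr 1
      ext a b
      simp [Matrix.mul_apply])
    (fun Y hY => by
      by_contra hd
      have h2 := Matrix.rank_of_det_ne_zero hd
      have h3 := (Matrix.rank_mul_le_left (C' * Y) E').trans (Matrix.rank_mul_le_right C' Y)
      rw [h2, hY.2.2.2] at h3
      simp at h3)
  have h4 : ∀ t : ℂ, C' * (P + t • X) * E' = fromBlocks (1 + t • (C * X * E))
      (t • (C * X * replicateCol Unit z)) (t • (replicateRow Unit y * X * E))
      (t • (replicateRow Unit y * X * replicateCol Unit z)) := by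
    intro t
    simp only [C', E']
    rw [Matrix.fromRows_mul, Matrix.fromRows_mul_fromCols]
    congr 1
    · rw [Matrix.mul_add, Matrix.add_mul, h1]; simp
    · rw [Matrix.mul_add, Matrix.add_mul, Matrix.mul_assoc C P, hPz]; simp
    · rw [Matrix.mul_add, Matrix.add_mul, hyP]; simp
    · rw [Matrix.mul_add, Matrix.add_mul, hyP]; simp
  simp only [h4] at h
  have h5 := (hasDerivAt_det_fromBlocks _ _ _ _).unique h
  rw [Matrix.mul_assoc, ← Matrix.replicateCol_mulVec] at h5
  simpa [Matrix.mul_apply, dotProduct] using h5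

theorem sum_entries_eq_trace {m : ℕ} (S X : Matrix (Fin m) (Fin m) ℂ) (hS : S.IsSymm) :
    ∑ i, ∑ j, S i j * X i j = (S * X).trace := by
  rw [Finset.sum_comm]
  simp only [Matrix.trace, Matrix.diag, Matrix.mul_apply]
  exact Finset.sum_congr rfl fun i _ => Finset.sum_congr rfl fun j _ => by rw [hS.apply]

/-- Tangent vectors are orthogonal to the symmetric matrices whose columns lie in the kernel. -/
theorem trace_eq_zero_of_mem_tangentSpace {m r : ℕ} {P X S : Matrix (Fin m) (Fin m) ℂ}
    (hX : X ∈ tangentSpace (SM m r) P) (hP : P ∈ SM m r) (hS : S.IsSymm) (hPS : P * S = 0) :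
    (S * X).trace = 0 := by
  obtain ⟨C, E, -, h2⟩ := exists_factor_of_rank_eq hP.1 hP.2.2.2
  -- `N` is a projection onto `ker P`; hence `S = N S Nᵀ`, and only the part `Nᵀ X N` of `X` on the
  -- kernel contributes to the trace.
  let N : Matrix (Fin m) (Fin m) ℂ := 1 - E * C * P
  have hPN : P * N = 0 := by
    simp only [N, Matrix.mul_sub, Matrix.mul_one]
    rw [sub_eq_zero]
    conv_lhs => rw [← h2]
    simp only [Matrix.mul_assoc]
  have hNS : N * S = S := by
    simp only [N, Matrix.sub_mul, Matrix.one_mul, Matrix.mul_assoc, hPS, Matrix.mul_zero, sub_zero]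
  have hSN : S * Nᵀ = S := by
    conv_lhs => rw [← hS.eq, ← Matrix.transpose_mul, hNS, hS.eq]
  have hNXN : Nᵀ * X * N = 0 := by
    ext i j
    have hcol : ∀ j, P *ᵥ (fun k => N k j) = 0 := fun j => by
      ext i
      exact congrFun (congrFun hPN i) j
    have := dotProduct_eq_zero_of_mem_tangentSpace hX hP (hcol i) (hcol j)
    rw [Matrix.mul_assoc]
    simpa [Matrix.mul_apply, Matrix.mulVec, dotProduct] using this
  calc (S * X).trace = (N * (S * Nᵀ) * X).trace := by rw [hSN, hNS]
    _ = (S * (Nᵀ * X * N)).trace := by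
      rw [Matrix.mul_assoc, Matrix.trace_mul_comm]
      simp only [Matrix.mul_assoc]
    _ = 0 := by rw [hNXN, Matrix.mul_zero, Matrix.trace_zero]

/-- The tangent vectors of `SM m r` given by the action of the general linear group. -/
theorem mem_tangentSpace_of_action {m r : ℕ} {P : Matrix (Fin m) (Fin m) ℂ} (hP : P ∈ SM m r)
    (A : Matrix (Fin m) (Fin m) ℂ) (hA : ∑ i, ∑ j, (A * P + P * Aᵀ) i j = 0) :
    A * P + P * Aᵀ ∈ tangentSpace (SM m r) P := by
  obtain ⟨hsymm, hne, hsum, hrank⟩ := hP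
  -- The congruence by `1 + tA` preserves the rank for small `t`, and rescaling restores the entry
  -- sum `2`. As the entry sum of the velocity is zero, `σ' = 0` at `0`, and rescaling does not
  -- change the velocity.
  let δ : ℂ → Matrix (Fin m) (Fin m) ℂ := fun t => (1 + t • A) * P * (1 + t • A)ᵀ
  let σ : ℂ → ℂ := fun t => ∑ i, ∑ j, δ t i j
  let γ : ℂ → Matrix (Fin m) (Fin m) ℂ := fun t => (2 / σ t) • δ t
  have hδ0 : δ 0 = P := by simp [δ]
  have hσ0 : σ 0 = 2 := by simp only [σ, hδ0, hsum]
  have hγ0 : γ 0 = P := by simp [γ, hδ0, hσ0]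
  have hexp : ∀ t, δ t = P + t • (A * P + P * Aᵀ) + t ^ 2 • (A * P * Aᵀ) := by
    intro t
    simp only [δ, Matrix.transpose_add, Matrix.transpose_one, Matrix.transpose_smul,
      Matrix.add_mul, Matrix.mul_add, Matrix.one_mul, Matrix.mul_one, Matrix.smul_mul,
      Matrix.mul_smul, smul_add, smul_smul, pow_two]
    abel
  have hδ : ∀ i j, HasDerivAt (fun t => δ t i j) ((A * P + P * Aᵀ) i j) 0 := by
    intro i j
    have h1 := (((hasDerivAt_id (0 : ℂ)).mul_const ((A * P + P * Aᵀ) i j)).const_add (P i j)).add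
      (((hasDerivAt_id (0 : ℂ)).pow 2).mul_const ((A * P * Aᵀ) i j))
    refine (h1.congr_deriv (by simp)).congr_of_eventuallyEq (Filter.Eventually.of_forall fun t => ?_)
    simp [hexp, mul_add]
  have hσ : HasDerivAt σ 0 0 := by
    have h1 := HasDerivAt.fun_sum (u := Finset.univ) fun i _ =>
      HasDerivAt.fun_sum (u := Finset.univ) fun j _ => hδ i j
    rwa [hA] at h1
  have hγ : ∀ i j, HasDerivAt (fun t => γ t i j) ((A * P + P * Aᵀ) i j) 0 := by
    intro i j
    have h1 := ((hasDerivAt_const (0 : ℂ) (2 : ℂ)).div hσ (by rw [hσ0]; exact two_ne_zero)).mul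
      (hδ i j)
    refine h1.congr_deriv ?_
    simp [hσ0]
  have hγc : ∀ i j, ContinuousAt (fun t => γ t i j) 0 := fun i j => (hγ i j).continuousAt
  have hdet : ContinuousAt (fun t : ℂ => (1 + t • A).det) 0 := by
    refine Continuous.continuousAt ?_
    fun_prop
  have e1 : ∀ᶠ t in nhds (0 : ℂ), ∀ i j, γ t i j ≠ 0 := by
    rw [Filter.eventually_all]
    intro i
    rw [Filter.eventually_all]
    intro j
    exact (hγc i j).eventually_ne (by rw [hγ0]; exact hne i j)
  have e2 : ∀ᶠ t in nhds (0 : ℂ), (1 + t • A).det ≠ 0 := hdet.eventually_ne (by simp)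
  have e3 : ∀ᶠ t in nhds (0 : ℂ), σ t ≠ 0 :=
    hσ.continuousAt.eventually_ne (by rw [hσ0]; exact two_ne_zero)
  have h := mem_tangentSpace_of_curve (Z := SM m r) hγ ?_
  · rwa [hγ0] at h
  · filter_upwards [e1, e2, e3] with t h1 h2 h3
    refine ⟨?_, h1, ?_, ?_⟩
    · refine Matrix.IsSymm.smul ?_ _
      simp only [δ, Matrix.IsSymm, Matrix.transpose_mul, Matrix.transpose_transpose, hsymm.eq,
        Matrix.mul_assoc]
    · simp only [γ, Matrix.smul_apply, smul_eq_mul, ← Finset.mul_sum]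
      exact div_mul_cancel₀ _ h3
    · simp only [γ, δ]
      rw [Matrix.rank_smul_of_mem_nonZeroDivisors _
        (mem_nonZeroDivisors_of_ne_zero (div_ne_zero two_ne_zero h3)),
        Matrix.rank_mul_eq_left_of_det_ne_zero _ _ (by rwa [Matrix.det_transpose]),
        Matrix.rank_mul_eq_right_of_det_ne_zero _ _ h2, hrank]

/-! ### The likelihood equations in matrix form. -/

/-- The matrix all of whose entries are `1`. -/
def ones (m : ℕ) : Matrix (Fin m) (Fin m) ℂ := Matrix.of fun _ _ => 1

/-- The entrywise quotient of two matrices. -/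
noncomputable def quot {m : ℕ} (U P : Matrix (Fin m) (Fin m) ℂ) : Matrix (Fin m) (Fin m) ℂ :=
  Matrix.of fun i j => U i j / P i j

/-- The matrix whose columns lie in the kernel of each critical point `P`. -/
noncomputable def residual {m : ℕ} (U P : Matrix (Fin m) (Fin m) ℂ) : Matrix (Fin m) (Fin m) ℂ :=
  quot U P - (totalSum U / 2) • ones m

theorem isSymm_ones (m : ℕ) : (ones m).IsSymm := rfl

theorem isSymm_dataMatrix {m : ℕ} (u : Sym2 (Fin m) → ℂ) : (dataMatrix u).IsSymm := by
  ext i j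
  by_cases h : i = j
  · subst h; rfl
  · simp [dataMatrix, h, Ne.symm h, Sym2.eq_swap]

theorem isSymm_quot {m : ℕ} {U P : Matrix (Fin m) (Fin m) ℂ} (hU : U.IsSymm) (hP : P.IsSymm) :
    (quot U P).IsSymm := by
  ext i j
  simp [quot, hU.apply i j, hP.apply i j]

theorem isSymm_residual {m : ℕ} {U P : Matrix (Fin m) (Fin m) ℂ} (hU : U.IsSymm) (hP : P.IsSymm) :
    (residual U P).IsSymm :=
  (isSymm_quot hU hP).sub ((isSymm_ones m).smul _)

theorem trace_mul_ones {m : ℕ} (P : Matrix (Fin m) (Fin m) ℂ) :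
    (P * ones m).trace = ∑ i, ∑ j, P i j := by
  simp [Matrix.trace, Matrix.mul_apply, ones]

theorem trace_mul_quot {m : ℕ} {U P : Matrix (Fin m) (Fin m) ℂ} (hP : P.IsSymm)
    (hne : ∀ i j, P i j ≠ 0) : (P * quot U P).trace = totalSum U := by
  rw [← sum_entries_eq_trace _ _ hP, totalSum]
  exact Finset.sum_congr rfl fun i _ => Finset.sum_congr rfl fun j _ =>
    mul_div_cancel₀ _ (hne i j)

theorem ones_mul_mul_ones {m : ℕ} (P : Matrix (Fin m) (Fin m) ℂ) :
    ones m * P * ones m = (∑ i, ∑ j, P i j) • ones m := by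
  ext i j
  simpa [Matrix.mul_apply, ones] using Finset.sum_comm

/-- The logarithmic derivative in matrix form. -/
theorem logDerivative_eq {m : ℕ} (u : Sym2 (Fin m) → ℂ) {P X : Matrix (Fin m) (Fin m) ℂ}
    (hP : P.IsSymm) (hX : X.IsSymm) :
    logDerivative u P X = (quot (dataMatrix u) P * X).trace / 2 := by
  rw [← sum_entries_eq_trace _ _ (isSymm_quot (isSymm_dataMatrix u) hP), eq_div_iff two_ne_zero]
  let t : Fin m → Fin m → ℂ := fun i j => u s(i, j) * (coord X i j / coord P i j)
  have ht : ∀ i j, t i j = t j i := by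
    intro i j
    by_cases h : i = j
    · subst h; rfl
    · simp [t, coord, h, Ne.symm h, Sym2.eq_swap, hP.apply i j, hX.apply i j]
  have h1 : logDerivative u P X = ∑ i, ∑ j, if i ≤ j then t i j else 0 := by
    rw [logDerivative, upper, Finset.sum_filter, Fintype.sum_prod_type]
  have h2 : logDerivative u P X = ∑ i, ∑ j, if j ≤ i then t i j else 0 := by
    rw [h1, Finset.sum_comm]
    exact Finset.sum_congr rfl fun i _ => Finset.sum_congr rfl fun j _ => by rw [ht]
  -- Adding the sums over `i ≤ j` and `j ≤ i` counts the diagonal twice, which matches `U i i = 2 *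
  -- u i i`; the halves in `coord` cancel in the quotient.
  rw [mul_two]
  nth_rewrite 1 [h1]
  rw [h2, ← Finset.sum_add_distrib]
  refine Finset.sum_congr rfl fun i _ => ?_
  rw [← Finset.sum_add_distrib]
  refine Finset.sum_congr rfl fun j _ => ?_
  rcases lt_trichotomy i j with h | h | h
  · simp [h.le, h.not_ge, h.ne, t, quot, dataMatrix, coord]
    ring
  · subst h
    simp [t, quot, dataMatrix, coord]
    rw [div_div_div_cancel_right₀ two_ne_zero]
    ring
  · simp [h.le, h.not_ge, h.ne', t, quot, dataMatrix, coord]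
    ring

/-- The two summands are exchanged by transposition, as `P` and `M` are symmetric. This turns a
pairing with tangent vectors into a pairing of `P * M` with an arbitrary matrix `A`. -/
theorem trace_mul_action {m : ℕ} {P M : Matrix (Fin m) (Fin m) ℂ} (hP : P.IsSymm) (hM : M.IsSymm)
    (A : Matrix (Fin m) (Fin m) ℂ) : (M * (A * P + P * Aᵀ)).trace = 2 * (P * M * A).trace := by
  have h1 : (M * (A * P)).trace = (P * M * A).trace := by
    rw [← Matrix.mul_assoc, Matrix.trace_mul_cycle]
  have h2 : (M * (P * Aᵀ)).trace = (P * M * A).trace := by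
    rw [← h1, ← Matrix.trace_transpose, Matrix.transpose_mul, Matrix.transpose_mul,
      Matrix.transpose_transpose, hP.eq, hM.eq, Matrix.trace_mul_comm]
  rw [Matrix.mul_add, Matrix.trace_add, h1, h2, two_mul]

/-- The likelihood equations in matrix form. -/
theorem mem_criticalPoints_iff {m r : ℕ} {u : Sym2 (Fin m) → ℂ} {P : Matrix (Fin m) (Fin m) ℂ} :
    P ∈ criticalPoints m r u ↔ P ∈ SM m r ∧ P * residual (dataMatrix u) P = 0 := by
  have hU := isSymm_dataMatrix u
  constructor
  · rintro ⟨hP, hcrit⟩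
    refine ⟨hP, ?_⟩
    obtain ⟨hsymm, hne, hsum, -⟩ := id hP
    have hR := isSymm_quot hU hsymm
    have hker : ∀ A : Matrix (Fin m) (Fin m) ℂ, (P * ones m * A).trace = 0 →
        (P * quot (dataMatrix u) P * A).trace = 0 := by
      intro A hA
      have hsymmX : (A * P + P * Aᵀ).IsSymm := by
        simp [Matrix.IsSymm, hsymm.eq, add_comm]
      have h0 : ∑ i, ∑ j, (A * P + P * Aᵀ) i j = 0 := by
        rw [← trace_mul_ones, Matrix.trace_mul_comm, trace_mul_action hsymm (isSymm_ones m), hA,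
          mul_zero]
      have h1 := hcrit _ (mem_tangentSpace_of_action hP A h0)
      rw [logDerivative_eq u hsymm hsymmX, trace_mul_action hsymm hR] at h1
      simpa using h1
    refine Matrix.ext_iff_trace_mul_right.2 fun A => ?_
    rw [Matrix.zero_mul, Matrix.trace_zero]
    -- Since `tr(PJ) = 2`, subtracting this multiple of the identity makes any `A` admissible; `tr(P
    -- (U/P)) = U₊₊` then yields the multiplier `U₊₊/2`.
    have h2 := hker (A - ((P * ones m * A).trace / 2) • 1) (by
      simp [Matrix.mul_sub, trace_mul_ones, hsum])
    rw [Matrix.mul_sub, Matrix.trace_sub, Matrix.mul_smul, Matrix.mul_one, Matrix.trace_smul,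
      trace_mul_quot hsymm hne] at h2
    rw [residual, Matrix.mul_sub, Matrix.mul_smul, Matrix.sub_mul, Matrix.trace_sub,
      Matrix.smul_mul, Matrix.trace_smul, ← h2]
    simp only [smul_eq_mul]
    ring
  · rintro ⟨hP, hres⟩
    refine ⟨hP, fun X hX => ?_⟩
    have hXs := isSymm_of_mem_tangentSpace hX hP.1
    have h1 := trace_eq_zero_of_mem_tangentSpace hX hP (isSymm_residual hU hP.1) hres
    rw [residual, Matrix.sub_mul, Matrix.smul_mul, Matrix.trace_sub, Matrix.trace_smul,
      Matrix.trace_mul_comm (ones m), trace_mul_ones, sum_eq_zero_of_mem_tangentSpace hX,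
      smul_zero, sub_zero] at h1
    rw [logDerivative_eq u hP.1 hXs, h1, zero_div]

theorem mul_quot_eq {m : ℕ} {U P : Matrix (Fin m) (Fin m) ℂ} (h : P * residual U P = 0) :
    P * quot U P = (totalSum U / 2) • (P * ones m) := by
  rw [residual, Matrix.mul_sub, Matrix.mul_smul, sub_eq_zero] at h
  exact h

theorem quot_mul_eq {m : ℕ} {U P : Matrix (Fin m) (Fin m) ℂ} (hU : U.IsSymm) (hP : P.IsSymm)
    (h : P * residual U P = 0) : quot U P * P = (totalSum U / 2) • (ones m * P) := by
  have := congrArg Matrix.transpose (mul_quot_eq h)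
  rwa [Matrix.transpose_mul, Matrix.transpose_smul, Matrix.transpose_mul, hP.eq,
    (isSymm_quot hU hP).eq, (isSymm_ones m).eq] at this

/-- The critical points have prescribed row sums. -/
theorem diagonal_rowSum_mul_ones {m : ℕ} {U P : Matrix (Fin m) (Fin m) ℂ} (hU : U.IsSymm)
    (hP : P.IsSymm) (hne : ∀ i j, P i j ≠ 0) (h : P * residual U P = 0) :
    diagonal (rowSum U) * ones m = (totalSum U / 2) • (P * ones m) := by
  ext i j
  -- On the diagonal the entries of `P` cancel against the denominators of the quotient.
  have h1 : (P * quot U P) i i = rowSum U i := by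
    rw [Matrix.mul_apply]
    refine Finset.sum_congr rfl fun k _ => ?_
    rw [(isSymm_quot hU hP).apply]
    exact mul_div_cancel₀ _ (hne i k)
  rw [mul_quot_eq h] at h1
  rw [Matrix.diagonal_mul]
  simpa [Matrix.mul_apply, ones] using h1.symm

theorem ones_mul_diagonal_rowSum {m : ℕ} {U P : Matrix (Fin m) (Fin m) ℂ} (hU : U.IsSymm)
    (hP : P.IsSymm) (hne : ∀ i j, P i j ≠ 0) (h : P * residual U P = 0) :
    ones m * diagonal (rowSum U) = (totalSum U / 2) • (ones m * P) := by
  have := congrArg Matrix.transpose (diagonal_rowSum_mul_ones hU hP hne h)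
  rwa [Matrix.transpose_mul, Matrix.transpose_smul, Matrix.transpose_mul, hP.eq,
    Matrix.diagonal_transpose, (isSymm_ones m).eq] at this

/-! ### The dual of a critical point. -/

/-- Adding back a multiple of the all-ones matrix raises the rank of the residual by one. -/
theorem rank_quot {m : ℕ} {U P : Matrix (Fin m) (Fin m) ℂ} (hU : U.IsSymm) (hP : P.IsSymm)
    (hsum : ∑ i, ∑ j, P i j = 2) (hU0 : totalSum U ≠ 0) (h : P * residual U P = 0) :
    (quot U P).rank = (residual U P).rank + 1 := by
  let v : Fin m → ℂ := fun _ => 1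
  have hvPv : v ⬝ᵥ P *ᵥ v = 2 := by
    rw [← hsum]
    simp [v, dotProduct, Matrix.mulVec]
  have hJ : ∀ w, ones m *ᵥ w = (v ⬝ᵥ w) • v := by
    intro w
    ext i
    simp [ones, v, Matrix.mulVec, dotProduct]
  have hS : ∀ w, residual U P *ᵥ w = quot U P *ᵥ w - (totalSum U / 2 * (v ⬝ᵥ w)) • v := by
    intro w
    rw [residual, Matrix.sub_mulVec, Matrix.smul_mulVec, hJ, smul_smul]
  have hv0 : v ≠ 0 := by
    intro h0
    rw [h0] at hvPv
    simp at hvPv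
  -- `(U/P) P v = (U₊₊/2) J P v = U₊₊ v`, because `vᵀ P v = 2`.
  have hv : v ∈ LinearMap.range (quot U P).mulVecLin := by
    refine ⟨(totalSum U)⁻¹ • P *ᵥ v, ?_⟩
    rw [Matrix.mulVecLin_apply, Matrix.mulVec_smul, Matrix.mulVec_mulVec, quot_mul_eq hU hP h,
      Matrix.smul_mulVec, ← Matrix.mulVec_mulVec, hJ, hvPv, smul_smul, smul_smul]
    convert one_smul ℂ v using 2
    field_simp
  have hrange : LinearMap.range (quot U P).mulVecLin
      = LinearMap.range (residual U P).mulVecLin ⊔ Submodule.span ℂ {v} := by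
    apply le_antisymm
    · rintro _ ⟨w, rfl⟩
      have : (quot U P).mulVecLin w
          = (residual U P).mulVecLin w + (totalSum U / 2 * (v ⬝ᵥ w)) • v := by
        simp [hS]
      rw [this]
      exact Submodule.add_mem_sup ⟨w, rfl⟩ (Submodule.smul_mem _ _ (Submodule.mem_span_singleton_self v))
    · refine sup_le ?_ ((Submodule.span_singleton_le_iff_mem _ _).2 hv)
      rintro _ ⟨w, rfl⟩
      rw [Matrix.mulVecLin_apply, hS]
      exact Submodule.sub_mem _ ⟨w, rfl⟩ (Submodule.smul_mem _ _ hv)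
  -- `P` kills the range of the residual but not `v`, as `vᵀ P v = 2`.
  have hdisj : Disjoint (LinearMap.range (residual U P).mulVecLin) (Submodule.span ℂ {v}) := by
    rw [Submodule.disjoint_span_singleton' hv0]
    rintro ⟨w, hw⟩
    have h1 : P *ᵥ v = 0 := by
      rw [← hw, Matrix.mulVecLin_apply, Matrix.mulVec_mulVec, h, Matrix.zero_mulVec]
    rw [h1] at hvPv
    simp at hvPv
  have h1 := Submodule.finrank_sup_add_finrank_inf_eq (LinearMap.range (residual U P).mulVecLin)
    (Submodule.span ℂ {v})
  rw [hdisj.eq_bot, finrank_bot, add_zero, ← hrange, finrank_span_singleton hv0] at h1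
  exact h1

theorem dual_eq {m : ℕ} (U P : Matrix (Fin m) (Fin m) ℂ) :
    dual U P = (4 / totalSum U ^ 3) • (diagonal (rowSum U) * quot U P * diagonal (rowSum U)) := by
  ext i j
  simp only [dual, quot, Matrix.smul_apply, Matrix.of_apply, Matrix.mul_diagonal,
    Matrix.diagonal_mul]
  ring_nf

/-- The numerators `U i j` cancel, leaving `P` up to scaling of rows and columns; compared with
`dual_eq`, the roles of `P` and `quot U P` are interchanged. -/
theorem quot_dual {m : ℕ} {U P : Matrix (Fin m) (Fin m) ℂ} (hne : ∀ i j, U i j ≠ 0)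
    (hrow : ∀ i, rowSum U i ≠ 0) (ht : totalSum U ≠ 0) (hP : ∀ i j, P i j ≠ 0) :
    quot U (dual U P) = (4 / totalSum U ^ 3)⁻¹ •
      (diagonal (fun i => (rowSum U i)⁻¹) * P * diagonal (fun i => (rowSum U i)⁻¹)) := by
  ext i j
  have h1 := hne i j
  have h2 := hrow i
  have h3 := hrow j
  have h4 := hP i j
  simp only [dual, quot, Matrix.smul_apply, Matrix.of_apply, Matrix.mul_diagonal,
    Matrix.diagonal_mul, smul_eq_mul]
  field_simp

theorem dual_dual {m : ℕ} {U P : Matrix (Fin m) (Fin m) ℂ} (hne : ∀ i j, U i j ≠ 0)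
    (hrow : ∀ i, rowSum U i ≠ 0) (ht : totalSum U ≠ 0) (hP : ∀ i j, P i j ≠ 0) :
    dual U (dual U P) = P := by
  ext i j
  have h1 := hne i j
  have h2 := hrow i
  have h3 := hrow j
  have h4 := hP i j
  simp only [dual, Matrix.smul_apply, Matrix.of_apply, smul_eq_mul]
  field_simp

/-- The dual of a critical point is a critical point, if the residual has maximal rank. -/
theorem dual_mem_criticalPoints {m r : ℕ} {u : Sym2 (Fin m) → ℂ}
    (hne : ∀ i j, dataMatrix u i j ≠ 0) (hrow : ∀ i, rowSum (dataMatrix u) i ≠ 0)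
    (ht : totalSum (dataMatrix u) ≠ 0) {P : Matrix (Fin m) (Fin m) ℂ}
    (hP : P ∈ criticalPoints m r u) (hrank : (residual (dataMatrix u) P).rank = m - r) :
    dual (dataMatrix u) P ∈ criticalPoints m (m - r + 1) u := by
  have hU := isSymm_dataMatrix u
  set U := dataMatrix u with hUdef
  obtain ⟨⟨hsymm, hP0, hsum, -⟩, hres⟩ := mem_criticalPoints_iff.1 hP
  have hk : (4 / totalSum U ^ 3 : ℂ) ≠ 0 := div_ne_zero (by norm_num) (pow_ne_zero _ ht)
  set D := diagonal (rowSum U) with hD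
  set D' := diagonal (fun i => (rowSum U i)⁻¹) with hD'
  have hDD' : D * D' = 1 := by
    rw [hD, hD', Matrix.diagonal_mul_diagonal, ← Matrix.diagonal_one]
    congr 1
    ext i
    exact mul_inv_cancel₀ (hrow i)
  have hdetD : D.det ≠ 0 := by
    rw [hD, Matrix.det_diagonal]
    exact Finset.prod_ne_zero_iff.2 fun i _ => hrow i
  have hDJ := diagonal_rowSum_mul_ones hU hsymm hP0 hres
  have hJD := ones_mul_diagonal_rowSum hU hsymm hP0 hres
  have hRP := quot_mul_eq hU hsymm hres
  have hJPJ : ones m * P * ones m = (2 : ℂ) • ones m := by rw [ones_mul_mul_ones, hsum]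
  -- Both terms of the critical equation for the dual turn out to be `D * ones m`. Here three
  -- factors `U₊₊/2` and the entry sum `2` appear, so the constant `4/U₊₊³` is the one with `2
  -- (U₊₊/2)³ · 4/U₊₊³ = 1`.
  have hmulones : (totalSum U / 2) • (dual U P * ones m) = D * ones m := by
    rw [dual_eq, Matrix.smul_mul, Matrix.mul_assoc, hDJ, Matrix.mul_smul, Matrix.mul_assoc D,
      ← Matrix.mul_assoc (quot U P), hRP, Matrix.smul_mul, hJPJ, Matrix.mul_smul, Matrix.mul_smul,
      smul_smul, smul_smul, smul_smul, smul_smul, ← hDJ]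
    convert one_smul ℂ (D * ones m) using 2
    field_simp
    norm_num
  have hmulquot : dual U P * quot U (dual U P) = D * ones m := by
    rw [quot_dual hne hrow ht hP0, dual_eq, Matrix.smul_mul, Matrix.mul_smul, smul_smul,
      mul_inv_cancel₀ hk, one_smul]
    calc D * quot U P * D * (D' * P * D') = D * (quot U P * ((D * D') * P)) * D' := by
          simp only [Matrix.mul_assoc]
      _ = D * (ones m * D) * D' := by rw [hDD', Matrix.one_mul, hRP, hJD]
      _ = D * ones m := by rw [Matrix.mul_assoc, Matrix.mul_assoc, hDD', Matrix.mul_one]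
  refine mem_criticalPoints_iff.2 ⟨⟨?_, fun i j => ?_, ?_, ?_⟩, ?_⟩
  · rw [dual_eq]
    refine Matrix.IsSymm.smul ?_ _
    rw [Matrix.IsSymm, Matrix.transpose_mul, Matrix.transpose_mul, Matrix.diagonal_transpose,
      (isSymm_quot hU hsymm).eq, Matrix.mul_assoc]
  · simp only [dual, Matrix.smul_apply, Matrix.of_apply, smul_eq_mul]
    exact mul_ne_zero hk (div_ne_zero (mul_ne_zero (mul_ne_zero (hrow i) (hne i j)) (hrow j))
      (hP0 i j))
  · have h1 := congrArg Matrix.trace hmulones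
    rw [Matrix.trace_smul, trace_mul_ones, trace_mul_ones, smul_eq_mul] at h1
    have h2 : ∑ i, ∑ j, D i j = totalSum U := by
      simp [hD, Matrix.diagonal_apply, totalSum, rowSum]
    rw [h2] at h1
    field_simp at h1
    simpa using h1
  · rw [dual_eq, Matrix.rank_smul_of_mem_nonZeroDivisors _ (mem_nonZeroDivisors_of_ne_zero hk),
      Matrix.rank_mul_eq_left_of_det_ne_zero _ _ hdetD,
      Matrix.rank_mul_eq_right_of_det_ne_zero _ _ hdetD, rank_quot hU hsymm hsum ht hres, hrank]
  · rw [residual, Matrix.mul_sub, Matrix.mul_smul, ← hUdef, hmulquot, hmulones, sub_self]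

/-- The product of the likelihoods of `P` and of its dual depends on the data only. -/
theorem exists_likelihood_mul_likelihood_dual {m : ℕ} (n : Sym2 (Fin m) → ℕ)
    (U : Matrix (Fin m) (Fin m) ℂ) : ∃ c : ℂ, ∀ P : Matrix (Fin m) (Fin m) ℂ,
      (∀ i j, P i j ≠ 0) → likelihood n P * likelihood n (dual U P) = c := by
  -- The factor `1/4` on the diagonal comes from halving the diagonal entries of both matrices in
  -- `coord`.
  refine ⟨∏ a ∈ upper m, ((if a.1 = a.2 then 1 / 4 else 1) * (4 / totalSum U ^ 3 *
    (rowSum U a.1 * U a.1 a.2 * rowSum U a.2))) ^ n s(a.1, a.2), fun P hP => ?_⟩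
  rw [likelihood, likelihood, ← Finset.prod_mul_distrib]
  refine Finset.prod_congr rfl fun a _ => ?_
  rw [← mul_pow]
  congr 1
  have h := hP a.1 a.2
  obtain ⟨i, j⟩ := a
  simp only at h
  by_cases hij : i = j
  · subst hij
    simp only [coord, dual, if_true, Matrix.smul_apply, Matrix.of_apply, smul_eq_mul]
    field_simp
    norm_num
  · simp only [coord, dual, if_neg hij, Matrix.smul_apply, Matrix.of_apply, smul_eq_mul]
    field_simp

/-! ### Charts for critical points and the dimension count. -/

/-- The index set of the free parameters of a chart. -/
abbrev ChartIndex (r s : ℕ) : Type := Sym2 (Fin r) ⊕ (Fin r × Fin s) ⊕ Sym2 (Fin s)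

section Chart

variable {R R' : Type*} [CommRing R] [CommRing R'] {r s : ℕ}

/-- The symmetric block `A` of the chart with parameters `x`. -/
def chartA (x : ChartIndex r s → R) : Matrix (Fin r) (Fin r) R :=
  Matrix.of fun i j => x (Sum.inl s(i, j))

/-- The rectangular block `X` of the chart with parameters `x`. -/
def chartX (x : ChartIndex r s → R) : Matrix (Fin r) (Fin s) R :=
  Matrix.of fun i j => x (Sum.inr (Sum.inl (i, j)))

/-- The symmetric block `T` of the chart with parameters `x`. -/
def chartT (x : ChartIndex r s → R) : Matrix (Fin s) (Fin s) R :=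
  Matrix.of fun i j => x (Sum.inr (Sum.inr s(i, j)))

/-- The matrix `[1 X]ᵀ A [1 X]`. -/
def chartImage (x : ChartIndex r s → R) : Matrix (Fin r ⊕ Fin s) (Fin r ⊕ Fin s) R :=
  fromBlocks (chartA x) (chartA x * chartX x) ((chartX x)ᵀ * chartA x)
    ((chartX x)ᵀ * chartA x * chartX x)

/-- The matrix `[-X; 1] T [-X; 1]ᵀ`, whose product with `chartImage` vanishes. -/
def chartKernel (x : ChartIndex r s → R) : Matrix (Fin r ⊕ Fin s) (Fin r ⊕ Fin s) R :=
  fromBlocks (chartX x * chartT x * (chartX x)ᵀ) (-(chartX x * chartT x))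
    (-(chartT x * (chartX x)ᵀ)) (chartT x)

/-- Compatibility with ring maps lets the chart with indeterminate parameters be evaluated at
complex ones. -/
theorem map_chartImage (f : R →+* R') (x : ChartIndex r s → R) :
    (chartImage x).map f = chartImage fun i => f (x i) := by
  have hA : (chartA x).map f = chartA fun i => f (x i) := rfl
  have hX : (chartX x).map f = chartX fun i => f (x i) := rfl
  simp only [chartImage, Matrix.fromBlocks_map, Matrix.map_mul, Matrix.transpose_map, hA, hX]

theorem map_chartKernel (f : R →+* R') (x : ChartIndex r s → R) :
    (chartKernel x).map f = chartKernel fun i => f (x i) := by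
  have hT : (chartT x).map f = chartT fun i => f (x i) := rfl
  have hX : (chartX x).map f = chartX fun i => f (x i) := rfl
  have hneg : ∀ {p q : Type} (M : Matrix p q R), (-M).map f = -(M.map f) := fun M => by
    ext; simp
  simp only [chartKernel, Matrix.fromBlocks_map, Matrix.map_mul, Matrix.transpose_map, hneg, hT, hX]

end Chart

theorem exists_chart_params {R : Type*} {r s : ℕ} {A : Matrix (Fin r) (Fin r) R} (hA : A.IsSymm)
    (X : Matrix (Fin r) (Fin s) R) {T : Matrix (Fin s) (Fin s) R} (hT : T.IsSymm) :
    ∃ x : ChartIndex r s → R, chartA x = A ∧ chartX x = X ∧ chartT x = T :=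
  ⟨Sum.elim (Sym2.lift ⟨A, fun i j => hA.apply j i⟩)
    (Sum.elim (fun p => X p.1 p.2) (Sym2.lift ⟨T, fun i j => hT.apply j i⟩)), rfl, rfl, rfl⟩

/-- The dimension count behind both the maximal rank of residuals and the finiteness of critical
points: `r(r+1)/2 + rs + s(s+1)/2 = (r+s)(r+s+1)/2`. -/
theorem card_chartIndex {m r s : ℕ} (hm : m = r + s) :
    Nat.card (ChartIndex r s) = Nat.card (Sym2 (Fin m)) := by
  subst hm
  simp only [Nat.card_eq_fintype_card, Fintype.card_sum, Fintype.card_prod, Sym2.card,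
    Fintype.card_fin, Nat.choose_two_right, Nat.add_sub_cancel]
  have h : ∀ n : ℕ, 2 * ((n + 1) * n / 2) = (n + 1) * n := fun n =>
    Nat.two_mul_div_two_of_even (mul_comm n (n + 1) ▸ Nat.even_mul_succ_self n)
  apply Nat.eq_of_mul_eq_mul_left two_pos
  rw [mul_add, mul_add, h, h, h]
  ring

/-- The data for which the chart with given parameters describes a critical point. -/
noncomputable def chartData {m r s : ℕ} (e : Fin r ⊕ Fin s ≃ Fin m) (a : Sym2 (Fin m)) :
    MvPolynomial (ChartIndex r s) ℂ :=
  C (if (Quot.out a).1 = (Quot.out a).2 then 1 / 2 else 1) *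
    (chartImage X (e.symm (Quot.out a).1) (e.symm (Quot.out a).2) *
      (chartKernel X (e.symm (Quot.out a).1) (e.symm (Quot.out a).2) + 1))

theorem eval_chartImage {r s : ℕ} (x : ChartIndex r s → ℂ) (i j : Fin r ⊕ Fin s) :
    eval x (chartImage X i j) = chartImage x i j := by
  have := congrFun (congrFun (map_chartImage (eval x) (X : ChartIndex r s → _)) i) j
  simpa using this

theorem eval_chartKernel {r s : ℕ} (x : ChartIndex r s → ℂ) (i j : Fin r ⊕ Fin s) :
    eval x (chartKernel X i j) = chartKernel x i j := by
  have := congrFun (congrFun (map_chartKernel (eval x) (X : ChartIndex r s → _)) i) j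
  simpa using this

/-- Every critical point lies in one of the charts. -/
theorem exists_chart_of_mem_criticalPoints {m r s : ℕ} (hm : m = r + s) {u : Sym2 (Fin m) → ℂ}
    (ht : totalSum (dataMatrix u) ≠ 0) {P : Matrix (Fin m) (Fin m) ℂ}
    (hP : P ∈ criticalPoints m r u) :
    ∃ (e : Fin r ⊕ Fin s ≃ Fin m) (x : ChartIndex r s → ℂ),
      (∀ a, eval x (chartData e a) = u a) ∧
      ((totalSum (dataMatrix u) / 2) • P).submatrix e e = chartImage x ∧
      ((totalSum (dataMatrix u) / 2)⁻¹ • residual (dataMatrix u) P).submatrix e e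
        = chartKernel x := by
  have hU := isSymm_dataMatrix u
  obtain ⟨⟨hsymm, hP0, -, hrank⟩, hres⟩ := mem_criticalPoints_iff.1 hP
  set c := totalSum (dataMatrix u) / 2 with hc
  have hc0 : c ≠ 0 := div_ne_zero ht two_ne_zero
  obtain ⟨e, A, X', hA, hAu, hPe⟩ := exists_symm_chart hm (hsymm.smul c)
    (by rw [Matrix.rank_smul_of_mem_nonZeroDivisors _ (mem_nonZeroDivisors_of_ne_zero hc0), hrank])
  obtain ⟨T, hT, hSe⟩ := eq_of_chart_mul_eq_zero hAu
    (((isSymm_residual hU hsymm).smul c⁻¹).submatrix e) (X := X') (by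
      rw [← hPe, Matrix.submatrix_mul_equiv, Matrix.smul_mul, Matrix.mul_smul, hres]
      simp)
  obtain ⟨x, rfl, rfl, rfl⟩ := exists_chart_params hA X' hT
  refine ⟨e, x, fun a => ?_, hPe, hSe⟩
  -- Since `c⁻¹R + J = c⁻¹(U/P)`, the entrywise product with `cP` is `U`. The scaling by `c` removes
  -- the total sum from the formula and makes the data polynomial in the parameters.
  have hval : ∀ i j, chartImage x (e.symm i) (e.symm j) * (chartKernel x (e.symm i) (e.symm j) + 1)
      = dataMatrix u i j := by
    intro i j
    rw [show chartImage x = _ from hPe.symm, show chartKernel x = _ from hSe.symm]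
    have := hP0 i j
    simp only [Matrix.submatrix_apply, Equiv.apply_symm_apply, Matrix.smul_apply, smul_eq_mul,
      residual, quot, ones, Matrix.sub_apply, Matrix.of_apply, ← hc]
    field_simp
    ring
  have ha : s((Quot.out a).1, (Quot.out a).2) = a := Quot.out_eq a
  rw [chartData, map_mul, map_mul, map_add, eval_chartImage, eval_chartKernel, eval_C, map_one,
    hval]
  conv_rhs => rw [← ha]
  by_cases hij : (Quot.out a).1 = (Quot.out a).2
  · simp [dataMatrix, hij]
  · simp [dataMatrix, hij]

/-- For general data the residual of each critical point has maximal rank. -/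
theorem forGeneral_rank_residual {m r : ℕ} (hrm : r ≤ m) :
    ForGeneral fun u : Sym2 (Fin m) → ℂ => totalSum (dataMatrix u) ≠ 0 →
      ∀ P ∈ criticalPoints m r u, (residual (dataMatrix u) P).rank = m - r := by
  have hm : m = r + (m - r) := by omega
  let g : MvPolynomial (ChartIndex r (m - r)) ℂ := (chartT X).det
  have hg : ∀ x, eval x g = (chartT x).det := by
    intro x
    simp only [g]
    rw [RingHom.map_det]
    congr 1
    ext i j
    simp [chartT]
  have hg0 : g ≠ 0 := by
    intro h
    obtain ⟨x, -, -, hx⟩ := exists_chart_params (R := ℂ) (r := r) (s := m - r) (A := 0)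
      Matrix.isSymm_zero 0 (T := 1) Matrix.isSymm_one
    have := hg x
    rw [h, hx, Matrix.det_one, map_zero] at this
    exact zero_ne_one this
  refine (forGeneral_forall fun e : Fin r ⊕ Fin (m - r) ≃ Fin m =>
    forGeneral_ne_zero_of_param (card_chartIndex hm).le (chartData e) hg0).mono
      fun u hu ht P hP => ?_
  obtain ⟨e, x, hx, -, hS⟩ := exists_chart_of_mem_criticalPoints hm ht hP
  have hdet := hu e x hx
  rw [hg] at hdet
  obtain ⟨⟨-, -, -, hrank⟩, hres⟩ := mem_criticalPoints_iff.1 hP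
  have hc0 : (totalSum (dataMatrix u) / 2)⁻¹ ≠ 0 := inv_ne_zero (div_ne_zero ht two_ne_zero)
  -- The upper bound is `P R = 0`; for the lower bound, the invertible `T` is a block of the
  -- rescaled residual.
  apply le_antisymm
  · have := Matrix.rank_add_rank_le_card_of_mul_eq_zero hres
    rw [hrank, Fintype.card_fin] at this
    omega
  · have h1 := Matrix.rank_submatrix_le (chartKernel x) Sum.inr Sum.inr
    have h2 : (chartKernel x).submatrix Sum.inr Sum.inr = chartT x := rfl
    rw [h2, Matrix.rank_of_det_ne_zero hdet, Fintype.card_fin, ← hS] at h1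
    refine h1.trans ?_
    rw [Matrix.rank_submatrix,
      Matrix.rank_smul_of_mem_nonZeroDivisors _ (mem_nonZeroDivisors_of_ne_zero hc0)]

/-- The number of critical points is bounded for general data. -/
theorem exists_forGeneral_encard_le {m r : ℕ} (hrm : r ≤ m) :
    ∃ K : ℕ, ForGeneral fun u : Sym2 (Fin m) → ℂ => totalSum (dataMatrix u) ≠ 0 →
      (criticalPoints m r u).encard ≤ K := by
  classical
  have hm : m = r + (m - r) := by omega
  choose K hK using fun (e : Fin r ⊕ Fin (m - r) ≃ Fin m) (a : Fin m × Fin m) =>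
    exists_forGeneral_finset_of_param (card_chartIndex hm).le (chartData e)
      (chartImage X (e.symm a.1) (e.symm a.2))
  -- In each chart `e`, the entry of `cP` at position `a` takes at most `K e a` values; a critical
  -- point is determined by its entries.
  refine ⟨∏ a, ∑ e, K e a, (forGeneral_forall fun e => forGeneral_forall fun a => hK e a).mono
    fun u hu ht => ?_⟩
  choose t htK ht' using hu
  have hc0 : totalSum (dataMatrix u) / 2 ≠ 0 := div_ne_zero ht two_ne_zero
  let Φ : Matrix (Fin m) (Fin m) ℂ → Fin m × Fin m → ℂ := fun P a =>
    (totalSum (dataMatrix u) / 2) * P a.1 a.2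
  have hΦ : Function.Injective Φ := by
    intro P Q h
    ext i j
    exact mul_left_cancel₀ hc0 (congrFun h (i, j))
  let F : Finset (Fin m × Fin m → ℂ) := Fintype.piFinset fun a => Finset.univ.biUnion fun e => t e a
  have hsub : Φ '' criticalPoints m r u ⊆ F := by
    rintro _ ⟨P, hP, rfl⟩
    obtain ⟨e, x, hx, hPe, -⟩ := exists_chart_of_mem_criticalPoints hm ht hP
    rw [Finset.mem_coe, Fintype.mem_piFinset]
    intro a
    refine Finset.mem_biUnion.2 ⟨e, Finset.mem_univ _, ?_⟩
    have h1 := ht' e a x hx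
    rw [eval_chartImage, ← hPe] at h1
    simpa [Φ] using h1
  rw [← hΦ.encard_image]
  refine (Set.encard_le_encard hsub).trans ?_
  rw [Set.encard_coe_eq_coe_finsetCard, Nat.cast_le, Fintype.card_piFinset]
  exact Finset.prod_le_prod' fun a _ => Finset.card_biUnion_le.trans
    (Finset.sum_le_sum fun e _ => htK e a)

/-! ### Non-vanishing conditions on the data. -/

theorem forGeneral_of_eval {σ : Type*} {f : (σ → ℂ) → ℂ} (p : MvPolynomial σ ℂ)
    (hp : ∀ u, eval u p = f u) (u₀ : σ → ℂ) (h : f u₀ ≠ 0) : ForGeneral fun u => f u ≠ 0 := by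
  refine (forGeneral_eval_ne_zero (F := p) fun h0 => h ?_).mono fun u hu => by rwa [← hp]
  rw [← hp, h0, map_zero]

/-- For general data the entries, the row sums, and the sum of the data matrix are non-zero. -/
theorem forGeneral_dataMatrix_ne_zero {m : ℕ} (hm : 1 ≤ m) :
    ForGeneral fun u : Sym2 (Fin m) → ℂ => (∀ i j, dataMatrix u i j ≠ 0) ∧
      (∀ i, rowSum (dataMatrix u) i ≠ 0) ∧ totalSum (dataMatrix u) ≠ 0 := by
  let p : Fin m → Fin m → MvPolynomial (Sym2 (Fin m)) ℂ := fun i j =>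
    if i = j then 2 * X s(i, i) else X s(i, j)
  have hp : ∀ u i j, eval u (p i j) = dataMatrix u i j := by
    intro u i j
    by_cases h : i = j <;> simp [p, dataMatrix, h]
  -- For data constantly `1` the data matrix is the all-ones matrix plus the identity, so all
  -- quantities in question are positive integers.
  have h1 : ∀ i j : Fin m, dataMatrix (fun _ => 1) i j = 1 + if i = j then 1 else 0 := by
    intro i j
    by_cases h : i = j <;> simp [dataMatrix, h]
    norm_num
  have h2 : ∀ i : Fin m, rowSum (dataMatrix fun _ => 1) i = (m + 1 : ℕ) := by
    intro i
    simp [rowSum, h1, Finset.sum_add_distrib]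
  have h3 : totalSum (dataMatrix fun _ : Sym2 (Fin m) => 1) = (m * (m + 1) : ℕ) := by
    have : totalSum (dataMatrix fun _ : Sym2 (Fin m) => 1)
        = ∑ i, rowSum (dataMatrix fun _ => 1) i := rfl
    rw [this]
    simp [h2]
    ring
  refine ForGeneral.and ?_ (ForGeneral.and ?_ ?_)
  · refine forGeneral_forall fun i => forGeneral_forall fun j =>
      forGeneral_of_eval (p i j) (fun u => hp u i j) (fun _ => 1) ?_
    rw [h1]
    split_ifs <;> norm_num
  · refine forGeneral_forall fun i => forGeneral_of_eval (∑ j, p i j) (fun u => ?_) (fun _ => 1) ?_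
    · simp [hp, rowSum]
    · rw [h2]
      exact Nat.cast_ne_zero.2 (by omega)
  · refine forGeneral_of_eval (∑ i, ∑ j, p i j) (fun u => ?_) (fun _ => 1) ?_
    · simp [hp, totalSum]
    · rw [h3]
      exact Nat.cast_ne_zero.2 (by positivity)

/-- A polynomial vanishing on all of `ℂ^σ` is zero. This permits comparing two bounds, each valid
for general data, at a common point. -/
theorem ForGeneral.exists {σ : Type*} {S : (σ → ℂ) → Prop} (h : ForGeneral S) : ∃ u, S u := by
  obtain ⟨F, hF, hu⟩ := h
  by_contra hS
  push Not at hS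
  refine hF (MvPolynomial.funext fun u => ?_)
  rw [map_zero]
  exact not_not.1 fun h0 => hS u (hu u h0)

/-! ### Polynomial conditions and the existence of the ML-degree. -/

/-- A function given by a polynomial. -/
def IsPolynomialFunction {ι : Type*} (f : (ι → ℂ) → ℂ) : Prop :=
  ∃ p : MvPolynomial ι ℂ, ∀ v, eval v p = f v

/-- A condition given by a system of polynomial equations. -/
def IsAlgebraicCondition {ι : Type*} (T : (ι → ℂ) → Prop) : Prop :=
  ∃ I : Set (MvPolynomial ι ℂ), ∀ v, T v ↔ ∀ p ∈ I, eval v p = 0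

section Polynomial

variable {ι : Type*} {f g : (ι → ℂ) → ℂ}

theorem IsPolynomialFunction.const (c : ℂ) : IsPolynomialFunction fun _ : ι → ℂ => c :=
  ⟨C c, fun _ => eval_C c⟩

theorem IsPolynomialFunction.proj (i : ι) : IsPolynomialFunction fun v : ι → ℂ => v i :=
  ⟨X i, fun _ => eval_X i⟩

theorem IsPolynomialFunction.add (hf : IsPolynomialFunction f) (hg : IsPolynomialFunction g) :
    IsPolynomialFunction fun v => f v + g v := by
  obtain ⟨p, hp⟩ := hf
  obtain ⟨q, hq⟩ := hg
  exact ⟨p + q, fun v => by rw [map_add, hp, hq]⟩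

theorem IsPolynomialFunction.mul (hf : IsPolynomialFunction f) (hg : IsPolynomialFunction g) :
    IsPolynomialFunction fun v => f v * g v := by
  obtain ⟨p, hp⟩ := hf
  obtain ⟨q, hq⟩ := hg
  exact ⟨p * q, fun v => by rw [map_mul, hp, hq]⟩

theorem IsPolynomialFunction.sub (hf : IsPolynomialFunction f) (hg : IsPolynomialFunction g) :
    IsPolynomialFunction fun v => f v - g v := by
  obtain ⟨p, hp⟩ := hf
  obtain ⟨q, hq⟩ := hg
  exact ⟨p - q, fun v => by rw [map_sub, hp, hq]⟩

theorem IsPolynomialFunction.sum {κ : Type*} {s : Finset κ} {f : κ → (ι → ℂ) → ℂ}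
    (hf : ∀ k, IsPolynomialFunction (f k)) : IsPolynomialFunction fun v => ∑ k ∈ s, f k v := by
  choose p hp using hf
  exact ⟨∑ k ∈ s, p k, fun v => by simp only [map_sum, hp]⟩

theorem IsAlgebraicCondition.eq (hf : IsPolynomialFunction f) (hg : IsPolynomialFunction g) :
    IsAlgebraicCondition fun v => f v = g v := by
  obtain ⟨p, hp⟩ := hf.sub hg
  exact ⟨{p}, fun v => by simp [hp, sub_eq_zero]⟩

theorem IsAlgebraicCondition.forall {κ : Sort*} {T : κ → (ι → ℂ) → Prop}
    (hT : ∀ k, IsAlgebraicCondition (T k)) : IsAlgebraicCondition fun v => ∀ k, T k v := by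
  choose I hI using hT
  refine ⟨⋃ k, I k, fun v => ?_⟩
  simp only [hI, Set.mem_iUnion]
  exact ⟨fun h p ⟨k, hk⟩ => h k p hk, fun h k p hk => h p ⟨k, hk⟩⟩

theorem IsAlgebraicCondition.and {S T : (ι → ℂ) → Prop} (hS : IsAlgebraicCondition S)
    (hT : IsAlgebraicCondition T) : IsAlgebraicCondition fun v => S v ∧ T v := by
  obtain ⟨I, hI⟩ := hS
  obtain ⟨J, hJ⟩ := hT
  refine ⟨I ∪ J, fun v => ?_⟩
  simp only [hI, hJ, Set.mem_union]
  exact ⟨fun h p hp => hp.elim (h.1 p) (h.2 p), fun h => ⟨fun p hp => h p (Or.inl hp),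
    fun p hp => h p (Or.inr hp)⟩⟩

theorem IsAlgebraicCondition.matrix_eq {p q : Type*} {A B : (ι → ℂ) → Matrix p q ℂ}
    (hA : ∀ i j, IsPolynomialFunction fun v => A v i j)
    (hB : ∀ i j, IsPolynomialFunction fun v => B v i j) :
    IsAlgebraicCondition fun v => A v = B v := by
  simp only [← Matrix.ext_iff]
  exact .forall fun i => .forall fun j => .eq (hA i j) (hB i j)

theorem IsPolynomialFunction.matrix_mul {p q r : Type*} [Fintype q] {A : (ι → ℂ) → Matrix p q ℂ}
    {B : (ι → ℂ) → Matrix q r ℂ} (hA : ∀ i j, IsPolynomialFunction fun v => A v i j)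
    (hB : ∀ i j, IsPolynomialFunction fun v => B v i j) (i : p) (j : r) :
    IsPolynomialFunction fun v => (A v * B v) i j := by
  simp only [Matrix.mul_apply]
  exact .sum fun k => (hA i k).mul (hB k j)

end Polynomial

/-- An algebraic condition with parameters is either solvable for general parameters or unsolvable
for general parameters. -/
theorem IsAlgebraicCondition.forGeneral_or {σ τ : Type*} [Finite σ] [Finite τ]
    {T : (σ ⊕ τ → ℂ) → Prop} (hT : IsAlgebraicCondition T) :
    (ForGeneral fun u : σ → ℂ => ∃ x : τ → ℂ, T (Sum.elim u x)) ∨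
    ForGeneral fun u : σ → ℂ => ¬ ∃ x : τ → ℂ, T (Sum.elim u x) := by
  obtain ⟨I, hI⟩ := hT
  simp only [hI]
  exact forGeneral_or_forGeneral_not I

/-- This turns a lower bound on the number of points into the existence of a tuple, to which
elimination applies. -/
theorem natCast_le_encard_iff {α : Type*} {s : Set α} {k : ℕ} :
    (k : ℕ∞) ≤ s.encard ↔ ∃ f : Fin k → α, Function.Injective f ∧ ∀ a, f a ∈ s := by
  constructor
  · intro h
    obtain ⟨t, hts, ht⟩ := Set.exists_subset_encard_eq h
    have hfin : t.Finite := Set.finite_of_encard_eq_coe ht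
    have := hfin.fintype
    have hcard : Fintype.card t = k := by
      rw [Set.encard_eq_coe_toFinset_card, Nat.cast_inj, Set.toFinset_card] at ht
      exact ht
    let e := (Fintype.equivFinOfCardEq hcard).symm
    exact ⟨fun a => (e a : α), Subtype.val_injective.comp e.injective, fun a => hts (e a).2⟩
  · rintro ⟨f, hf, hs⟩
    have h1 := Set.encard_le_encard (Set.range_subset_iff.2 hs)
    rw [← Set.image_univ, hf.encard_image] at h1
    simpa using h1

/-- The unknowns of the system of equations for `k` distinct critical points `P`: the entries of
`P`, their inverses, the two matrices of a rank factorisation, and witnesses of distinctness. -/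
abbrev Unknowns (m r k : ℕ) : Type :=
  Fin k × ((Fin m × Fin m) ⊕ (Fin m × Fin m) ⊕ (Fin r × Fin m) ⊕ (Fin m × Fin r) ⊕
    (Fin k × Fin m × Fin m))

/-- The equations for a critical point `P` with entrywise inverse `V` and rank factorisation
`C`, `E`. -/
def CriticalEquations {m r : ℕ} (U P V : Matrix (Fin m) (Fin m) ℂ) (C : Matrix (Fin r) (Fin m) ℂ)
    (E : Matrix (Fin m) (Fin r) ℂ) : Prop :=
  Pᵀ = P ∧ (∀ i j, P i j * V i j = 1) ∧ ∑ i, ∑ j, P i j = 2 ∧ C * P * E = 1 ∧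
    P * E * (C * P) = P ∧
    P * (Matrix.of fun i j => U i j * V i j - totalSum U * (1 / 2)) = 0

theorem mem_criticalPoints_iff_exists {m r : ℕ} {u : Sym2 (Fin m) → ℂ}
    {P : Matrix (Fin m) (Fin m) ℂ} : P ∈ criticalPoints m r u ↔
      ∃ V C, ∃ E : Matrix (Fin m) (Fin r) ℂ, CriticalEquations (dataMatrix u) P V C E := by
  have hres : ∀ V : Matrix (Fin m) (Fin m) ℂ, (∀ i j, P i j * V i j = 1) →
      (Matrix.of fun i j => dataMatrix u i j * V i j - totalSum (dataMatrix u) * (1 / 2))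
        = residual (dataMatrix u) P := by
    intro V hV
    ext i j
    have h0 : P i j ≠ 0 := left_ne_zero_of_mul_eq_one (hV i j)
    have h1 : V i j = (P i j)⁻¹ := eq_inv_of_mul_eq_one_right (hV i j)
    simp [residual, quot, ones, h1]
    ring
  rw [mem_criticalPoints_iff]
  constructor
  · rintro ⟨⟨hsymm, hne, hsum, hrank⟩, h⟩
    obtain ⟨C, E, h1, h2⟩ := exists_factor_of_rank_eq hsymm hrank
    have hV : ∀ i j, P i j * (Matrix.of fun i j => (P i j)⁻¹ : Matrix _ _ ℂ) i j = 1 :=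
      fun i j => mul_inv_cancel₀ (hne i j)
    exact ⟨_, C, E, hsymm, hV, hsum, h1, h2, by rw [hres _ hV, h]⟩
  · rintro ⟨V, C, E, hsymm, hV, hsum, h1, h2, h3⟩
    rw [hres V hV] at h3
    exact ⟨⟨hsymm, fun i j => left_ne_zero_of_mul_eq_one (hV i j), hsum,
      rank_eq_of_factor h1 h2⟩, h3⟩

/-- For general data there are at least `k` critical points, or for general data there are fewer
than `k` of them. -/
theorem forGeneral_le_encard_or (m r k : ℕ) :
    (ForGeneral fun u : Sym2 (Fin m) → ℂ => (k : ℕ∞) ≤ (criticalPoints m r u).encard) ∨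
    ForGeneral fun u : Sym2 (Fin m) → ℂ => ¬ (k : ℕ∞) ≤ (criticalPoints m r u).encard := by
  let P : (Sym2 (Fin m) ⊕ Unknowns m r k → ℂ) → Fin k → Matrix (Fin m) (Fin m) ℂ :=
    fun v a => Matrix.of fun i j => v (Sum.inr (a, Sum.inl (i, j)))
  let V : (Sym2 (Fin m) ⊕ Unknowns m r k → ℂ) → Fin k → Matrix (Fin m) (Fin m) ℂ :=
    fun v a => Matrix.of fun i j => v (Sum.inr (a, Sum.inr (Sum.inl (i, j))))
  let C : (Sym2 (Fin m) ⊕ Unknowns m r k → ℂ) → Fin k → Matrix (Fin r) (Fin m) ℂ :=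
    fun v a => Matrix.of fun i j => v (Sum.inr (a, Sum.inr (Sum.inr (Sum.inl (i, j)))))
  let E : (Sym2 (Fin m) ⊕ Unknowns m r k → ℂ) → Fin k → Matrix (Fin m) (Fin r) ℂ :=
    fun v a => Matrix.of fun i j => v (Sum.inr (a, Sum.inr (Sum.inr (Sum.inr (Sum.inl (i, j))))))
  let L : (Sym2 (Fin m) ⊕ Unknowns m r k → ℂ) → Fin k → Fin k → Fin m → Fin m → ℂ :=
    fun v a b i j => v (Sum.inr (a, Sum.inr (Sum.inr (Sum.inr (Sum.inr (b, i, j))))))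
  let T : (Sym2 (Fin m) ⊕ Unknowns m r k → ℂ) → Prop := fun v =>
    (∀ a, CriticalEquations (dataMatrix fun s => v (Sum.inl s)) (P v a) (V v a) (C v a) (E v a)) ∧
    -- Distinctness as an equation: some linear combination of the entries of the difference equals
    -- `1`.
    ∀ a b, a ≠ b → ∑ i, ∑ j, L v a b i j * (P v a i j - P v b i j) = 1
  have hP : ∀ a i j, IsPolynomialFunction fun v => P v a i j := fun a i j => .proj _
  have hV : ∀ a i j, IsPolynomialFunction fun v => V v a i j := fun a i j => .proj _
  have hC : ∀ a i j, IsPolynomialFunction fun v => C v a i j := fun a i j => .proj _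
  have hE : ∀ a i j, IsPolynomialFunction fun v => E v a i j := fun a i j => .proj _
  have hL : ∀ a b i j, IsPolynomialFunction fun v => L v a b i j := fun a b i j => .proj _
  have hU : ∀ i j, IsPolynomialFunction fun v : Sym2 (Fin m) ⊕ Unknowns m r k → ℂ =>
      dataMatrix (fun s => v (Sum.inl s)) i j := by
    intro i j
    by_cases h : i = j
    · simp only [dataMatrix, Matrix.of_apply, if_pos h]
      exact .mul (.const 2) (.proj _)
    · simp only [dataMatrix, Matrix.of_apply, if_neg h]
      exact .proj _
  have hT : IsAlgebraicCondition T := by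
    refine .and (.forall fun a => ?_) (.forall fun a => .forall fun b => .forall fun _ =>
      .eq (.sum fun i => .sum fun j => (hL a b i j).mul ((hP a i j).sub (hP b i j))) (.const 1))
    have hCP := IsPolynomialFunction.matrix_mul (hC a) (hP a)
    refine .and (.matrix_eq (fun i j => hP a j i) (hP a)) (.and
      (.forall fun i => .forall fun j => .eq ((hP a i j).mul (hV a i j)) (.const 1)) (.and
      (.eq (.sum fun i => .sum fun j => hP a i j) (.const 2)) (.and
      (.matrix_eq (.matrix_mul hCP (hE a)) fun i j => .const _) (.and
      (.matrix_eq (.matrix_mul (.matrix_mul (hP a) (hE a)) hCP) (hP a))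
      (.matrix_eq (.matrix_mul (hP a) fun i j => ?_) fun i j => .const _)))))
    exact ((hU i j).mul (hV a i j)).sub ((IsPolynomialFunction.sum fun i =>
      IsPolynomialFunction.sum fun j => hU i j).mul (.const _))
  have hiff : ∀ u : Sym2 (Fin m) → ℂ, (∃ x, T (Sum.elim u x)) ↔
      (k : ℕ∞) ≤ (criticalPoints m r u).encard := by
    intro u
    rw [natCast_le_encard_iff]
    constructor
    · rintro ⟨x, h1, h2⟩
      refine ⟨P (Sum.elim u x), fun a b hab => ?_, fun a =>
        mem_criticalPoints_iff_exists.2 ⟨_, _, _, h1 a⟩⟩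
      by_contra hne
      have := h2 a b hne
      rw [hab] at this
      simp at this
    · rintro ⟨f, hf, hmem⟩
      choose V' C' E' h using fun a => mem_criticalPoints_iff_exists.1 (hmem a)
      have hdist : ∀ a b, ∃ L' : Fin m → Fin m → ℂ, a ≠ b →
          ∑ i, ∑ j, L' i j * (f a i j - f b i j) = 1 := by
        intro a b
        by_cases hab : a = b
        · exact ⟨0, fun h => (h hab).elim⟩
        · have hne : ∃ i j, f a i j ≠ f b i j := by
            by_contra hcon
            push Not at hcon
            exact hab (hf (Matrix.ext hcon))
          obtain ⟨i, j, hij⟩ := hne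
          refine ⟨fun i' j' => if i' = i ∧ j' = j then (f a i j - f b i j)⁻¹ else 0, fun _ => ?_⟩
          rw [Finset.sum_eq_single i (fun i' _ hi => by simp [hi]) (by simp),
            Finset.sum_eq_single j (fun j' _ hj => by simp [hj]) (by simp)]
          simp [inv_mul_cancel₀ (sub_ne_zero.2 hij)]
      choose L' hL' using hdist
      let x : Unknowns m r k → ℂ := fun q => match q with
        | (a, .inl (i, j)) => f a i j
        | (a, .inr (.inl (i, j))) => V' a i j
        | (a, .inr (.inr (.inl (i, j)))) => C' a i j
        | (a, .inr (.inr (.inr (.inl (i, j))))) => E' a i j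
        | (a, .inr (.inr (.inr (.inr (b, i, j))))) => L' a b i j
      exact ⟨x, h, hL'⟩
  simpa only [hiff] using hT.forGeneral_or

/-- The ML-degree exists. -/
theorem exists_isMLDegree {m r : ℕ} (hm : 1 ≤ m) (hrm : r ≤ m) : ∃ d, IsMLDegree m r d := by
  classical
  obtain ⟨K, hK⟩ := exists_forGeneral_encard_le hrm
  let G : ℕ → Prop := fun k =>
    ForGeneral fun u : Sym2 (Fin m) → ℂ => (k : ℕ∞) ≤ (criticalPoints m r u).encard
  have h0 : G 0 := forGeneral_of_forall fun u => by simp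
  have hbound : ∀ k, G k → k ≤ K := by
    intro k hk
    obtain ⟨u, h1, h2, h3⟩ := (hk.and (hK.and (forGeneral_dataMatrix_ne_zero hm))).exists
    exact_mod_cast h1.trans (h2 h3.2.2)
  -- The candidate is the largest `k` such that general data have at least `k` critical points. For
  -- its successor the dichotomy then says that general data have fewer.
  have hd : G (Nat.findGreatest G K) := Nat.findGreatest_spec (Nat.zero_le K) h0
  have hd' : ¬ G (Nat.findGreatest G K + 1) := fun h =>
    absurd (Nat.le_findGreatest (hbound _ h) h) (by omega)
  refine ⟨Nat.findGreatest G K, (hd.and ((forGeneral_le_encard_or m r _).resolve_left hd')).mono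
    fun u hu => le_antisymm ?_ hu.1⟩
  have h := hu.2
  rw [not_le] at h
  exact Order.le_of_lt_add_one (by exact_mod_cast h)

end MLDuality

/-! ### The duality theorem. -/

theorem mainTheorem2 (m r : ℕ) (hr : 1 ≤ r) (hrm : r ≤ m) :
    (MLDuality.ForGeneral fun u : Sym2 (Fin m) → ℂ =>
      Set.BijOn (MLDuality.dual (MLDuality.dataMatrix u))
        (MLDuality.criticalPoints m r u) (MLDuality.criticalPoints m (m - r + 1) u) ∧
      Set.InvOn (MLDuality.dual (MLDuality.dataMatrix u)) (MLDuality.dual (MLDuality.dataMatrix u))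
        (MLDuality.criticalPoints m r u) (MLDuality.criticalPoints m (m - r + 1) u) ∧
      ∀ n : Sym2 (Fin m) → ℕ, (∀ s, u s = (n s : ℂ)) →
        ∃ c : ℂ, ∀ P ∈ MLDuality.criticalPoints m r u,
          MLDuality.likelihood n P *
            MLDuality.likelihood n (MLDuality.dual (MLDuality.dataMatrix u) P) = c) ∧
    ∃ d : ℕ, MLDuality.IsMLDegree m r d ∧ MLDuality.IsMLDegree m (m - r + 1) d := by
  open MLDuality in
  have hs : m - r + 1 ≤ m := by omega
  -- With truncated subtraction, `r ↦ m - r + 1` is an involution only for `1 ≤ r ≤ m`.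
  have hdual : m - (m - r + 1) + 1 = r := by omega
  have hbij : ForGeneral fun u : Sym2 (Fin m) → ℂ =>
      Set.BijOn (dual (dataMatrix u)) (criticalPoints m r u) (criticalPoints m (m - r + 1) u) ∧
      Set.InvOn (dual (dataMatrix u)) (dual (dataMatrix u))
        (criticalPoints m r u) (criticalPoints m (m - r + 1) u) := by
    refine ((forGeneral_dataMatrix_ne_zero (hr.trans hrm)).and
      ((forGeneral_rank_residual hrm).and (forGeneral_rank_residual hs))).mono ?_
    rintro u ⟨⟨hne, hrow, ht⟩, h1, h2⟩
    have hinv : Set.InvOn (dual (dataMatrix u)) (dual (dataMatrix u))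
        (criticalPoints m r u) (criticalPoints m (m - r + 1) u) :=
      ⟨fun P hP => dual_dual hne hrow ht hP.1.2.1, fun P hP => dual_dual hne hrow ht hP.1.2.1⟩
    refine ⟨hinv.bijOn (fun P hP => dual_mem_criticalPoints hne hrow ht hP (h1 ht P hP))
      fun P hP => ?_, hinv⟩
    have := dual_mem_criticalPoints hne hrow ht hP (h2 ht P hP)
    rwa [hdual] at this
  refine ⟨hbij.mono fun u hu => ⟨hu.1, hu.2, fun n _ => ?_⟩, ?_⟩
  · obtain ⟨c, hc⟩ := exists_likelihood_mul_likelihood_dual n (dataMatrix u)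
    exact ⟨c, fun P hP => hc P hP.1.2.1⟩
  -- Only one ML-degree needs a separate existence proof; the bijection, valid for general data,
  -- transfers it to the dual rank.
  · obtain ⟨d, hd⟩ := exists_isMLDegree (hr.trans hrm) hrm
    exact ⟨d, hd, (hd.and hbij).mono fun u hu => by
      rw [← hu.2.1.image_eq, hu.2.1.injOn.encard_image]; exact hu.1⟩
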